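/- **Setting.** Let $(\Omega,\mathcal F,(\mathcal F_t),\mathbb P)$ be a filtered probability space in discrete or continuous time with $\mathcal F=\mathcal F_T$, and fix a time $t\le T$. Let $p,q\in[1,\infty]$ with $\frac1p+\frac1q=1$. Write $L^p_t(D)$ for the (classes of) $\mathcal F_t$-measurable, $p$-integrable random vectors with values a.s. in the (possibly random) set $D$, $L^p_d=L^p_T(\mathbb R^d)$, $L^q(D)=L^q_T(D)$; $L^p_d$ carries the norm topology if $p<\infty$ and the weak* topology $\sigma(L^\infty_d,L^1_d)$ if $p=\infty$. Let $1\le m\le d$, $M=\mathbb R^m\times\{0\}^{d-m}$, $M_+=M\cap\mathbb R^d_+$, $M_t=L^p_t(M)$, $M_{t,+}=L^p_t(M_+)$, $M_{t,-}=-M_{t,+}$. For $C\subseteq\mathbb R^d$ let $C^+=\{v\in\mathbb R^d: v^{\mathsf T}u\ge0\ \forall u\in C\}$, and let $M^\perp$ be the orthogonal space of $M$. Let $R_t$ be a conditional risk measure, i.e. a map from $L^p_d$ to the subsets of $M_t$ with $R_t(X)=R_t(X)+M_{t,+}$ for all $X$, such that (i) $Y-X\ge 0$ a.s. implies $R_t(X)\subseteq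 R_t(Y)$; (ii) $R_t(X+c)=R_t(X)-c$ for all $c\in M_t$; (iii) $R_t(0)$ is nonempty, closed, $\mathcal F_t$-decomposable, and $R_t(0)=L^p_t(\tilde R_t(0))$ for an $\mathcal F_t$-measurable random closed set $\tilde R_t(0)$ with $\mathbb P(\tilde R_t(0)=M)=0$. Assume that $R_t$ is normalized ($R_t(X)=R_t(X)+R_t(0)$ for all $X$); convex upper continuous ($\{X: R_t(X)\cap D\ne\emptyset\}$ is closed for every $D\subseteq M_t$ with $D=\operatorname{cl}\operatorname{co}(D+M_{t,-})$); and conditionally coherent, i.e. conditionally convex ($\lambda R_t(X)+(1-\lambda)R_t(Y)\subseteq R_t(\lambda X+(1-\lambda)Y)$ for all $X,Y$ and $\lambda\in L^\infty_t([0,1])$) and conditionally positive homogeneous ($\lambda R_t(X)\subseteq R_t(\lambda X)$ for all $X$ and $\lambda\in L^\infty_t((0,\infty))$; equality follows when $1/\lambda$ is bounded too). Let $A_t=\{X\in L^p_d: 0\in R_t(X)\}$ and $A_t^+=\{v\in L^q_d:\mathbb E[v^{\mathsf T}Z]\ge0\ \forall Z\in A_t\}$. For $w\in L^q_t(\tilde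 R_t(0)^+\setminus M^\perp)$ and $X\in L^p_d$ put $$\rho_t^w(X)=\operatorname{ess\,inf}\{w^{\mathsf T}u: u\in R_t(X)\},$$ and assume that $\rho_t^w(X)$ is integrable for all such $w$ and $X$. **Dual variables.** Let $\mathcal M^d$ be the set of $d$-tuples $\mathbb Q=(\mathbb Q_1,\dots,\mathbb Q_d)$ of probability measures absolutely continuous with respect to $\mathbb P$. Let $\xi_{t,T}(\mathbb Q)_i=\frac{\mathbb E[d\mathbb Q_i/d\mathbb P\mid\mathcal F_T]}{\mathbb E[d\mathbb Q_i/d\mathbb P\mid\mathcal F_t]}$ where the denominator is positive, and $1$ elsewhere. Put $w_t^T(\mathbb Q,w)=\operatorname{diag}(w)\,\xi_{t,T}(\mathbb Q)$ and $\mathbb E^{\mathbb Q}[X\mid\mathcal F_t]_i=\mathbb E[\xi_{t,T}(\mathbb Q)_iX_i\mid\mathcal F_t]$. Here conditional expectations are taken in the extended sense $\mathbb E[f^+\mid\mathcal F_t]-\mathbb E[f^-\mid\mathcal F_t]$; in the formula below both terms are finite wherever the weight $(w+m_\perp)_i$ is nonzero, and a component of weight zero contributes zero. Let $\mathcal W_t(w)$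 be the set of pairs $(\mathbb Q,m_\perp)\in\mathcal M^d\times L^q_t(M^\perp)$ with $w+m_\perp\in L^q_t(M_+^+\setminus M^\perp)$ and $w_t^T(\mathbb Q,w+m_\perp)\in L^q(\mathbb R^d_+)$, and let $$\mathcal W_t^R(w)=\{(\mathbb Q,m_\perp)\in\mathcal W_t(w): w_t^T(\mathbb Q,w+m_\perp)\in A_t^+\}.$$ **Claim.** For every $w\in L^q_t(\tilde R_t(0)^+\setminus M^\perp)$ and every $X\in L^p_d$, $$\rho_t^w(X)=\operatorname*{ess\,sup}_{(\mathbb Q,m_\perp)\in\mathcal W_t^R(w)}(w+m_\perp)^{\mathsf T}\,\mathbb E^{\mathbb Q}[-X\mid\mathcal F_t]\qquad\mathbb P\text{-a.s.}$$ -/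

import Mathlib

open MeasureTheory Set
open scoped ENNReal Pointwise

namespace SetRisk

noncomputable section

variable {Ω : Type*} {mΩ : MeasurableSpace Ω}

/-! ### Essential suprema and infima of families of random variables -/

/-- `Y` is the essential supremum of the (arbitrary, possibly uncountable) family `f` in
`L⁰(Ω, m, μ; [-∞, ∞])`. -/
structure IsFamEssSup {κ : Type*} (m : MeasurableSpace Ω) (μ : Measure[mΩ] Ω)
    (f : κ → Ω → EReal) (Y : Ω → EReal) : Prop where
  measurable : Measurable[m] Y
  upper : ∀ i, f i ≤ᵐ[μ] Y
  least : ∀ Z : Ω → EReal, Measurable[m] Z → (∀ i, f i ≤ᵐ[μ] Z) → Y ≤ᵐ[μ] Z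

/-- `Y` is the essential infimum of the family `f` in `L⁰(Ω, m, μ; [-∞, ∞])`. -/
structure IsFamEssInf {κ : Type*} (m : MeasurableSpace Ω) (μ : Measure[mΩ] Ω)
    (f : κ → Ω → EReal) (Y : Ω → EReal) : Prop where
  measurable : Measurable[m] Y
  lower : ∀ i, Y ≤ᵐ[μ] f i
  greatest : ∀ Z : Ω → EReal, Measurable[m] Z → (∀ i, Z ≤ᵐ[μ] f i) → Z ≤ᵐ[μ] Y

/-- An order embedding of `[-∞, ∞]` into `[0, 1]`. -/
def squash (x : EReal) : ℝ≥0∞ := ((EReal.exp x)⁻¹ + 1)⁻¹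

theorem squash_le_one (x : EReal) : squash x ≤ 1 := by
  unfold squash
  rw [ENNReal.inv_le_one]
  exact le_add_self

theorem squash_le_iff {x y : EReal} : squash x ≤ squash y ↔ x ≤ y := by
  unfold squash
  rw [ENNReal.inv_le_inv, ENNReal.add_le_add_iff_right (by simp), ENNReal.inv_le_inv]
  exact EReal.exp_strictMono.le_iff_le

theorem measurable_squash : Measurable squash :=
  ((EReal.measurable_exp.inv).add_const 1).inv

theorem exists_isFamEssSup {κ : Type*} {m : MeasurableSpace Ω} (hm : m ≤ mΩ) (μ : Measure[mΩ] Ω)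
    [IsFiniteMeasure μ] (f : κ → Ω → EReal) : ∃ Y, IsFamEssSup m μ f Y := by
  classical
  let S : Set (Ω → EReal) := {Z | Measurable[m] Z ∧ ∀ i, f i ≤ᵐ[μ] Z}
  let I : (Ω → EReal) → ℝ≥0∞ := fun Z => ∫⁻ ω, squash (Z ω) ∂μ
  have hne : (I '' S).Nonempty :=
    ⟨_, ⟨fun _ => ⊤, ⟨measurable_const, fun i => Filter.Eventually.of_forall fun _ => le_top⟩, rfl⟩⟩
  obtain ⟨u, -, hu, huS⟩ := exists_seq_tendsto_sInf hne (OrderBot.bddBelow _)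
  choose Z hZ hZu using huS
  have hY : (fun ω => ⨅ n, Z n ω) ∈ S := by
    refine ⟨Measurable.iInf fun n => (hZ n).1, fun i => ?_⟩
    have : ∀ᵐ ω ∂μ, ∀ n, f i ω ≤ Z n ω := ae_all_iff.2 fun n => (hZ n).2 i
    filter_upwards [this] with ω h using le_iInf h
  have hle : ∀ W ∈ S, I (fun ω => ⨅ n, Z n ω) ≤ I W := by
    intro W hW
    have h1 : I (fun ω => ⨅ n, Z n ω) ≤ sInf (I '' S) := by
      refine ge_of_tendsto' hu fun n => ?_
      rw [← hZu n]
      exact lintegral_mono fun ω => squash_le_iff.2 (iInf_le _ n)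
    exact h1.trans (sInf_le ⟨W, hW, rfl⟩)
  refine ⟨_, hY.1, hY.2, fun W hW hWu => ?_⟩
  set Y : Ω → EReal := fun ω => ⨅ n, Z n ω with hYdef
  have hmin : (fun ω => min (Y ω) (W ω)) ∈ S := by
    refine ⟨hY.1.min hW, fun i => ?_⟩
    filter_upwards [hY.2 i, hWu i] with ω h1 h2 using le_min h1 h2
  have hfin : I (fun ω => min (Y ω) (W ω)) ≠ ∞ := by
    refine ne_top_of_le_ne_top (measure_ne_top μ univ) ?_
    calc I (fun ω => min (Y ω) (W ω)) ≤ ∫⁻ _, 1 ∂μ := lintegral_mono fun ω => squash_le_one _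
      _ = μ univ := by simp
  have hae := ae_eq_of_ae_le_of_lintegral_le (μ := μ)
    (f := fun ω => squash (min (Y ω) (W ω))) (g := fun ω => squash (Y ω))
    (Filter.Eventually.of_forall fun ω => squash_le_iff.2 (min_le_left _ _)) hfin
    (by exact (measurable_squash.comp (hY.1.mono hm le_rfl)).aemeasurable) (hle _ hmin)
  filter_upwards [hae] with ω hω
  exact (squash_le_iff.1 hω.ge).trans (min_le_right _ _)

theorem exists_isFamEssInf {κ : Type*} {m : MeasurableSpace Ω} (hm : m ≤ mΩ) (μ : Measure[mΩ] Ω)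
    [IsFiniteMeasure μ] (f : κ → Ω → EReal) : ∃ Y, IsFamEssInf m μ f Y := by
  obtain ⟨Y, h1, h2, h3⟩ := exists_isFamEssSup hm μ (fun i ω => - f i ω)
  refine ⟨fun ω => - Y ω, continuous_neg.measurable.comp h1, fun i => ?_, fun Z hZ h => ?_⟩
  · filter_upwards [h2 i] with ω hω using EReal.neg_le_of_neg_le hω
  · have := h3 (fun ω => - Z ω) (continuous_neg.measurable.comp hZ) fun i => by
      filter_upwards [h i] with ω hω using EReal.neg_le_neg_iff.2 hω
    filter_upwards [this] with ω hω using EReal.le_neg_of_le_neg hω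

/-- The essential supremum (a version of it) of a family of random variables, in
`L⁰(Ω, m, μ; [-∞, ∞])`. -/
def famEssSup {κ : Type*} {m : MeasurableSpace Ω} (hm : m ≤ mΩ) (μ : Measure[mΩ] Ω)
    [IsFiniteMeasure μ] (f : κ → Ω → EReal) : Ω → EReal :=
  (exists_isFamEssSup hm μ f).choose

/-- The essential infimum (a version of it) of a family of random variables, in
`L⁰(Ω, m, μ; [-∞, ∞])`. -/
def famEssInf {κ : Type*} {m : MeasurableSpace Ω} (hm : m ≤ mΩ) (μ : Measure[mΩ] Ω)
    [IsFiniteMeasure μ] (f : κ → Ω → EReal) : Ω → EReal :=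
  (exists_isFamEssInf hm μ f).choose

theorem isFamEssSup_famEssSup {κ : Type*} {m : MeasurableSpace Ω} (hm : m ≤ mΩ) (μ : Measure[mΩ] Ω)
    [IsFiniteMeasure μ] (f : κ → Ω → EReal) : IsFamEssSup m μ f (famEssSup hm μ f) :=
  (exists_isFamEssSup hm μ f).choose_spec

theorem isFamEssInf_famEssInf {κ : Type*} {m : MeasurableSpace Ω} (hm : m ≤ mΩ) (μ : Measure[mΩ] Ω)
    [IsFiniteMeasure μ] (f : κ → Ω → EReal) : IsFamEssInf m μ f (famEssInf hm μ f) :=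
  (exists_isFamEssInf hm μ f).choose_spec

/-! ### Spaces of random vectors -/

/-- `Lᵖ(Ω, m, μ; D)` for a (random) set `D`: the classes in `Lᵖ(Ω, mΩ, μ; E)` that have an
`m`-measurable representative and take their values in `D` almost surely. -/
def LpIn {E : Type*} [NormedAddCommGroup E] (m : MeasurableSpace Ω) (p : ℝ≥0∞) (μ : Measure[mΩ] Ω)
    (D : Ω → Set E) : Set (Lp E p μ) :=
  {X | AEStronglyMeasurable[m] X μ ∧ ∀ᵐ ω ∂μ, X ω ∈ D ω}

/-- The topology used on `Lᵖ(Ω; ℝᵈ)`: the norm topology for `p < ∞`, and the weak* topology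
`σ(L^∞, L¹)` for `p = ∞`. -/
@[reducible]
def lpTopology {d : ℕ} (p : ℝ≥0∞) [Fact (1 ≤ p)] (μ : Measure[mΩ] Ω) :
    TopologicalSpace (Lp (Fin d → ℝ) p μ) :=
  open Classical in
  if p = ∞ then
    TopologicalSpace.induced
      (fun (X : Lp (Fin d → ℝ) p μ) (Y : Lp (Fin d → ℝ) 1 μ) => ∫ ω, Y ω ⬝ᵥ X ω ∂μ)
      Pi.topologicalSpace
  else inferInstance

/-- The eligible space `ℝᵐ × {0}^{d-m}`: only the first `m` coordinates may be nonzero. -/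
def eligibleSpace (d m : ℕ) : Submodule ℝ (Fin d → ℝ) where
  carrier := {v | ∀ i : Fin d, m ≤ (i : ℕ) → v i = 0}
  add_mem' := fun {a b} ha hb i hi => by simp [ha i hi, hb i hi]
  zero_mem' := fun _ _ => rfl
  smul_mem' := fun c a ha i hi => by simp [ha i hi]

/-- The orthogonal space `M^⊥` in `ℝᵈ`. -/
def perp {d : ℕ} (M : Submodule ℝ (Fin d → ℝ)) : Set (Fin d → ℝ) :=
  {v | ∀ u ∈ M, v ⬝ᵥ u = 0}

/-- The positive dual cone `C⁺` of a subset `C` of `ℝᵈ`. -/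
def dualCone {d : ℕ} (C : Set (Fin d → ℝ)) : Set (Fin d → ℝ) :=
  {v | ∀ u ∈ C, 0 ≤ v ⬝ᵥ u}

/-- `M_+ = M ∩ ℝᵈ_+`. -/
def posPart {d : ℕ} (M : Submodule ℝ (Fin d → ℝ)) : Set (Fin d → ℝ) := {v | v ∈ M ∧ 0 ≤ v}

section Spaces

variable {d : ℕ} (m : MeasurableSpace Ω) (p : ℝ≥0∞) (μ : Measure[mΩ] Ω)
  (M : Submodule ℝ (Fin d → ℝ))

/-- `M_t = Lᵖ_t(M)`. -/
def eligible : Set (Lp (Fin d → ℝ) p μ) := LpIn m p μ fun _ => (M : Set (Fin d → ℝ))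

/-- `M_{t,+} = Lᵖ_t(M_+)`. -/
def eligiblePos : Set (Lp (Fin d → ℝ) p μ) := LpIn m p μ fun _ => posPart M

/-- `M_{t,-} = - M_{t,+}`. -/
def eligibleNeg : Set (Lp (Fin d → ℝ) p μ) := - eligiblePos m p μ M

end Spaces

/-! ### Set-valued conditional risk measures -/

/-- `S` is an `m`-measurable random closed set in `ℝᵈ`. -/
structure IsRandomClosedSet {d : ℕ} (m : MeasurableSpace Ω) (S : Ω → Set (Fin d → ℝ)) : Prop where
  closed : ∀ ω, IsClosed (S ω)
  measurable : ∀ U : Set (Fin d → ℝ), IsOpen U → MeasurableSet[m] {ω | (S ω ∩ U).Nonempty}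

section RiskMeasure

variable {d : ℕ} (m : MeasurableSpace Ω) (p : ℝ≥0∞) [Fact (1 ≤ p)] (μ : Measure[mΩ] Ω)
  (M : Submodule ℝ (Fin d → ℝ))
  (R : Lp (Fin d → ℝ) p μ → Set (Lp (Fin d → ℝ) p μ))

/-- `S` is the random set `R̃_t(0)`: an `m`-measurable random closed set with
`R_t(0) = Lᵖ_t(S)`. -/
def IsZeroSet (S : Ω → Set (Fin d → ℝ)) : Prop :=
  IsRandomClosedSet m S ∧ R 0 = LpIn m p μ S

/-- `C` is decomposable with respect to `m`. -/
def IsDecomposable (C : Set (Lp (Fin d → ℝ) p μ)) : Prop :=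
  ∀ D : Set Ω, MeasurableSet[m] D → ∀ X ∈ C, ∀ Y ∈ C, ∀ Z : Lp (Fin d → ℝ) p μ,
    (∀ᵐ ω ∂μ, (ω ∈ D → Z ω = X ω) ∧ (ω ∉ D → Z ω = Y ω)) → Z ∈ C

/-- `R` is a conditional risk measure `Lᵖ_d → 𝒫(M_t; M_{t,+})` for the `σ`-algebra `m` of the
information at time `t`. -/
structure IsConditionalRiskMeasure : Prop where
  subset_eligible : ∀ X, R X ⊆ eligible m p μ M
  upper : ∀ X, R X = R X + eligiblePos m p μ M
  monotone : ∀ X Y, (∀ᵐ ω ∂μ, 0 ≤ (Y - X) ω) → R X ⊆ R Y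
  translative : ∀ X, ∀ c ∈ eligible m p μ M, R (X + c) = (fun u => u - c) '' R X
  zero_nonempty : (R 0).Nonempty
  zero_closed : @IsClosed _ (lpTopology p μ) (R 0)
  zero_decomposable : IsDecomposable m p μ (R 0)
  zero_finite : ∃ S, IsZeroSet m p μ R S ∧ ∀ᵐ ω ∂μ, S ω ≠ (M : Set (Fin d → ℝ))

/-- `R` is normalized. -/
def IsNormalized : Prop := ∀ X, R X = R X + R 0

/-- `R` is conditionally convex. -/
def IsCondConvex [IsFiniteMeasure μ] : Prop :=
  ∀ X Y, ∀ l ∈ LpIn (E := ℝ) m ∞ μ (fun _ => Icc 0 1),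
    (fun u => l • u) '' R X + (fun u => (Lp.const ∞ μ (1 : ℝ) - l) • u) '' R Y ⊆
      R (l • X + (Lp.const ∞ μ (1 : ℝ) - l) • Y)

/-- `R` is conditionally positive homogeneous. The inclusion for all `l ∈ L^∞_t(ℝ_{++})` says
that the acceptance set is a conditional cone, and it yields equality whenever `1 / l` is bounded
too. Equality cannot be asked for every `l`: at `X = 0` it would put `l⁻¹ • u` into `Lᵖ` for every
`u ∈ R 0` and every such `l`, which fails unless `m` is finite up to null sets. -/
def IsCondPosHomogeneous : Prop :=
  ∀ X, ∀ l ∈ LpIn (E := ℝ) m ∞ μ (fun _ => Ioi 0), (fun u => l • u) '' R X ⊆ R (l • X)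

/-- `R` is conditionally coherent. -/
def IsCondCoherent [IsFiniteMeasure μ] : Prop := IsCondConvex m p μ R ∧ IsCondPosHomogeneous m p μ R

/-- `R` is convex upper continuous: `{X | R X ∩ D ≠ ∅}` is closed for every closed
`D ∈ 𝒢(M_t; M_{t,-})`. -/
def IsConvexUpperContinuous : Prop :=
  ∀ D : Set (Lp (Fin d → ℝ) p μ), D ⊆ eligible m p μ M →
    D = @closure _ (lpTopology p μ) (convexHull ℝ (D + eligibleNeg m p μ M)) →
    @IsClosed _ (lpTopology p μ) {X | (R X ∩ D).Nonempty}

/-- The acceptance set `A_t` of `R`. -/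
def acceptanceSet : Set (Lp (Fin d → ℝ) p μ) := {X | 0 ∈ R X}

/-- The positive dual cone `A⁺ ⊆ L^q` of `A ⊆ Lᵖ`, as a set of (representatives of) random
vectors. -/
def lpDualCone (q : ℝ≥0∞) (A : Set (Lp (Fin d → ℝ) p μ)) : Set (Ω → Fin d → ℝ) :=
  {v | MemLp v q μ ∧ ∀ Z ∈ A, 0 ≤ ∫ ω, v ω ⬝ᵥ Z ω ∂μ}

variable {m p μ} in
/-- The scalarization `ρ_t^w(X) = ess inf {wᵀu | u ∈ R_t(X)}`. -/
def scalarization (hm : m ≤ mΩ) [IsFiniteMeasure μ] (w : Ω → Fin d → ℝ)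
    (X : Lp (Fin d → ℝ) p μ) : Ω → EReal :=
  famEssInf hm μ fun (u : R X) ω => ((w ω ⬝ᵥ (u : Lp (Fin d → ℝ) p μ) ω : ℝ) : EReal)

end RiskMeasure

/-! ### Dual variables -/

/-- The conditional expectation `E[f | m]` in the extended sense, `E[f⁺ | m] - E[f⁻ | m]`; it
does not ask `f` to be integrable, only that both terms are finite (the value is irrelevant where
they are not). -/
def genCondExp (m : MeasurableSpace Ω) (μ : Measure[mΩ] Ω) (f : Ω → ℝ) : Ω → ℝ := fun ω =>
  (condLExp m μ (fun ω' => ENNReal.ofReal (f ω')) ω).toReal -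
    (condLExp m μ (fun ω' => ENNReal.ofReal (-f ω')) ω).toReal

theorem genCondExp_eq_condExp (m : MeasurableSpace Ω) (μ : Measure[mΩ] Ω) {f : Ω → ℝ}
    (hf : Integrable f μ) : genCondExp m μ f =ᵐ[μ] μ[f | m] := by
  have key : ∀ g : Ω → ℝ, Integrable g μ →
      (fun ω => (condLExp m μ (fun ω' => ENNReal.ofReal (g ω')) ω).toReal) =ᵐ[μ]
        μ[fun ω => max (g ω) 0 | m] := by
    intro g hg
    have h := toReal_condLExp m (μ := μ) (f := fun ω => ENNReal.ofReal (g ω))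
      hg.aemeasurable.ennreal_ofReal (by
        refine ne_top_of_le_ne_top hg.2.ne (lintegral_mono fun ω => ?_)
        exact Real.ofReal_le_enorm _)
    simpa [ENNReal.toReal_ofReal'] using h
  have hsub := condExp_sub (m := m) (hf.pos_part) (hf.neg.pos_part)
  have hid : ((fun ω => max (f ω) 0) - fun ω => max ((-f) ω) 0) = f := by
    funext ω
    simp only [Pi.sub_apply, Pi.neg_apply]
    rcases le_total 0 (f ω) with h | h
    · rw [max_eq_left h, max_eq_right (by linarith)]; ring
    · rw [max_eq_right h, max_eq_left (by linarith)]; ring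
  rw [hid] at hsub
  filter_upwards [key f hf, key (-f) hf.neg, hsub] with ω h1 h2 h3
  simp only [genCondExp]
  simp only [Pi.neg_apply] at h2
  rw [h1, h2, h3]
  rfl

section Dual

variable {ι : Type*} [Preorder ι] (ℱ : Filtration ι mΩ) (μ : Measure Ω)

/-- `𝓜^d`: vectors of probability measures absolutely continuous with respect to `μ`. -/
def measureVectors (d : ℕ) : Set (Fin d → Measure Ω) :=
  {Q | ∀ i, IsProbabilityMeasure (Q i) ∧ Q i ≪ μ}

/-- `E[dν/dμ | ℱ_s]`. -/
def densityAt (s : ι) (ν : Measure Ω) : Ω → ℝ := μ[fun ω => (ν.rnDeriv μ ω).toReal | ℱ s]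

/-- The density quotient `ξ_{s,r}(ν) = E[dν/dμ | ℱ_r] / E[dν/dμ | ℱ_s]`, which is `1` where the
denominator is not positive. -/
def xi (s r : ι) (ν : Measure Ω) : Ω → ℝ := fun ω =>
  open Classical in
  if 0 < densityAt ℱ μ s ν ω then densityAt ℱ μ r ν ω / densityAt ℱ μ s ν ω else 1

variable {d : ℕ}

/-- The `μ`-almost sure version of the conditional expectation, `E^Q[X | ℱ_t]`, componentwise
`E[ξ_{t,T}(Q_i) X_i | ℱ_t]`. -/
def condExpQ (t T : ι) (Q : Fin d → Measure Ω) (X : Ω → Fin d → ℝ) : Ω → Fin d → ℝ :=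
  fun ω i => genCondExp (ℱ t) μ (fun ω' => xi ℱ μ t T (Q i) ω' * X ω' i) ω

/-- `w_t^s(Q, w) = diag(w) ξ_{t,s}(Q)`. -/
def transport (t s : ι) (Q : Fin d → Measure Ω) (w : Ω → Fin d → ℝ) : Ω → Fin d → ℝ :=
  fun ω i => w ω i * xi ℱ μ t s (Q i) ω

variable (M : Submodule ℝ (Fin d → ℝ)) (q : ℝ≥0∞)

/-- The set `𝒲_t` of dual variables. -/
def dualPairs (t T : ι) : Set ((Fin d → Measure Ω) × Lp (Fin d → ℝ) q μ) :=
  {x | x.1 ∈ measureVectors μ d ∧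
    x.2 ∈ LpIn (ℱ t) q μ (fun _ => dualCone (posPart M) \ perp M) ∧
    MemLp (transport ℱ μ t T x.1 x.2) q μ ∧
    ∀ᵐ ω ∂μ, 0 ≤ transport ℱ μ t T x.1 x.2 ω}

/-- `𝒲_t(w)`: the pairs `(Q, m_⊥) ∈ 𝓜^d × L^q_t(M^⊥)` with `(Q, w + m_⊥) ∈ 𝒲_t`. -/
def dualPairsAt (t T : ι) (w : Lp (Fin d → ℝ) q μ) :
    Set ((Fin d → Measure Ω) × Lp (Fin d → ℝ) q μ) :=
  {x | x.1 ∈ measureVectors μ d ∧ x.2 ∈ LpIn (ℱ t) q μ (fun _ => perp M) ∧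
    (x.1, w + x.2) ∈ dualPairs ℱ μ M q t T}

/-- `𝒲_t^R(w)`: the pairs `(Q, m_⊥) ∈ 𝒲_t(w)` with `w_t^T(Q, w + m_⊥) ∈ A_t⁺`. -/
def coherentDualPairs (t T : ι) {p : ℝ≥0∞} [Fact (1 ≤ p)]
    (R : Lp (Fin d → ℝ) p μ → Set (Lp (Fin d → ℝ) p μ)) (w : Lp (Fin d → ℝ) q μ) :
    Set ((Fin d → Measure Ω) × Lp (Fin d → ℝ) q μ) :=
  {x | x ∈ dualPairsAt ℱ μ M q t T w ∧
    transport ℱ μ t T x.1 ⇑(w + x.2) ∈ lpDualCone p μ q (acceptanceSet p μ R)}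

end Dual

end

end SetRisk

/-!
Weak duality: if `(Q, m_⊥)` is a dual pair and `u ∈ R_t(X)`, then `X + u` is acceptable. As `A_t` is
a conditional cone, the transported density, which is nonnegative on `A_t` in expectation, is so
conditionally on `ℱ_t`; and it prices `u ∈ M_t` at `wᵀu`.

For the converse it suffices to come arbitrarily close in expectation: an integrable `Y` equals an
essential supremum `V ≤ Y` of functions whose integrals come arbitrarily close to `E[Y]`. If
`a < E[wᵀu]` for all `u ∈ R_t(X)` and `e ∈ M_t` has price `E[wᵀe] = 1`, then `X + a e` lies outside
the convex cone of positions compensable at a nonpositive `w`-price, which convex upper continuity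
makes closed. A separating functional, given by an `L^q` density `v` and scaled to price `e` at
`1`, agrees with `w` on `M_t`. Hence `E[v | ℱ_t] - w` is orthogonal to `M`, and the measures `Q_i`
with density `v_i / E[v_i | ℱ_t]` make `v` a transported density of expected value above `a`.
-/

namespace SetRisk

section Riesz

open Filter Function Topology NNReal

variable {Ω : Type*} {mΩ : MeasurableSpace Ω} {μ : Measure Ω} {p q : ℝ≥0∞}
  {E F : Type*} [NormedAddCommGroup E] [NormedAddCommGroup F]

theorem eLpNorm_top_le_of_forall_lintegral_mul_le [SigmaFinite μ] {V : Ω → ℝ≥0∞}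
    (hV : Measurable V) {C : ℝ≥0∞}
    (h : ∀ f : Ω → ℝ≥0∞, Measurable f → ∫⁻ ω, V ω * f ω ∂μ ≤ C * eLpNorm f 1 μ) :
    eLpNorm V ∞ μ ≤ C := by
  rw [eLpNorm_exponent_top]
  refine essSup_le_of_ae_le C (ae_le_of_forall_setLIntegral_le_of_sigmaFinite hV fun s hs _ => ?_)
  have hs1 := h (s.indicator 1) (measurable_one.indicator hs)
  simp_rw [← indicator_mul_right, Pi.one_apply, mul_one] at hs1
  simpa [eLpNorm_one_eq_lintegral_enorm, lintegral_indicator hs] using hs1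

theorem le_rpow_of_le_mul_rpow {p q : ℝ} (hpq : p.HolderConjugate q) {x C : ℝ≥0∞}
    (hx : x ≠ ∞) (h : x ≤ C * x ^ (1 / p)) : x ≤ C ^ q := by
  rcases eq_or_ne x 0 with rfl | h0
  · exact zero_le
  have hsplit : x = x ^ (1 / q) * x ^ (1 / p) := by
    rw [← ENNReal.rpow_add _ _ h0 hx, one_div, one_div, hpq.symm.inv_add_inv_eq_one,
      ENNReal.rpow_one]
  have hroot : x ^ (1 / q) ≤ C := by
    refine (ENNReal.mul_le_mul_iff_left (c := x ^ (1 / p)) ?_ ?_).1 (hsplit ▸ h)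
    · exact (ENNReal.rpow_pos (pos_iff_ne_zero.2 h0) hx).ne'
    · exact ENNReal.rpow_ne_top_of_nonneg (one_div_nonneg.2 hpq.nonneg) hx
  calc x = (x ^ (1 / q)) ^ q := by
        rw [← ENNReal.rpow_mul, one_div_mul_cancel hpq.symm.ne_zero, ENNReal.rpow_one]
    _ ≤ C ^ q := ENNReal.rpow_le_rpow hroot hpq.symm.nonneg

theorem lintegral_rpow_le_of_forall_lintegral_mul_le [ENNReal.HolderConjugate p q]
    (hp : p ≠ ∞) (hq : q ≠ ∞) {V : Ω → ℝ≥0∞} (hV : Measurable V)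
    (hfin : ∫⁻ ω, V ω ^ q.toReal ∂μ ≠ ∞) {C : ℝ≥0∞}
    (h : ∀ f : Ω → ℝ≥0∞, Measurable f → ∫⁻ ω, V ω * f ω ∂μ ≤ C * eLpNorm f p μ) :
    ∫⁻ ω, V ω ^ q.toReal ∂μ ≤ C ^ q.toReal := by
  have hpq : p.toReal.HolderConjugate q.toReal := ENNReal.HolderConjugate.toReal_of_ne_top hp hq
  refine le_rpow_of_le_mul_rpow hpq hfin ?_
  calc ∫⁻ ω, V ω ^ q.toReal ∂μ = ∫⁻ ω, V ω * V ω ^ (q.toReal - 1) ∂μ := by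
        refine lintegral_congr fun ω => ?_
        nth_rw 2 [← ENNReal.rpow_one (V ω)]
        rw [← ENNReal.rpow_add_of_nonneg _ _ zero_le_one (sub_nonneg.2 hpq.symm.lt.le),
          add_sub_cancel]
    _ ≤ C * eLpNorm (fun ω => V ω ^ (q.toReal - 1)) p μ := h _ (by fun_prop)
    _ = C * (∫⁻ ω, V ω ^ q.toReal ∂μ) ^ (1 / p.toReal) := by
        rw [eLpNorm_eq_lintegral_rpow_enorm_toReal (ENNReal.HolderConjugate.ne_zero p q) hp]
        simp_rw [enorm_eq_self, ← ENNReal.rpow_mul, hpq.symm.sub_one_mul_conj]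

theorem eLpNorm_le_of_forall_lintegral_mul_le [IsFiniteMeasure μ]
    [ENNReal.HolderConjugate p q] (hp : p ≠ ∞) {V : Ω → ℝ≥0∞} (hV : Measurable V) {C : ℝ≥0∞}
    (h : ∀ f : Ω → ℝ≥0∞, Measurable f → ∫⁻ ω, V ω * f ω ∂μ ≤ C * eLpNorm f p μ) :
    eLpNorm V q μ ≤ C := by
  rcases eq_or_ne q ∞ with rfl | hq
  · obtain rfl : p = 1 := ENNReal.HolderConjugate.unique ∞ p 1
    exact eLpNorm_top_le_of_forall_lintegral_mul_le hV h
  have hr : 0 < q.toReal := (ENNReal.HolderConjugate.toReal_of_ne_top (p := p) hp hq).symm.pos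
  have hfin : ∀ n : ℕ, ∫⁻ ω, min (V ω) n ^ q.toReal ∂μ ≠ ∞ := fun n => by
    refine ne_top_of_le_ne_top (b := ∫⁻ _, (n : ℝ≥0∞) ^ q.toReal ∂μ) ?_
      (lintegral_mono fun ω => ENNReal.rpow_le_rpow (min_le_right _ _) hr.le)
    rw [lintegral_const]
    finiteness
  have htrunc : ∀ n : ℕ, ∫⁻ ω, min (V ω) n ^ q.toReal ∂μ ≤ C ^ q.toReal := fun n =>
    lintegral_rpow_le_of_forall_lintegral_mul_le hp hq (by fun_prop) (hfin n) fun f hf =>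
      (lintegral_mono fun ω => mul_le_mul_left (min_le_left _ _) _).trans (h f hf)
  have hsup : ∀ ω, V ω ^ q.toReal = ⨆ n : ℕ, min (V ω) n ^ q.toReal := fun ω => by
    have hω : V ω = ⨆ n : ℕ, min (V ω) n := by
      rw [← inf_iSup_eq, ENNReal.iSup_natCast, inf_top_eq]
    exact (congrArg (· ^ q.toReal) hω).trans ((ENNReal.orderIsoRpow q.toReal hr).map_iSup _)
  rw [eLpNorm_eq_lintegral_rpow_enorm_toReal (ENNReal.toReal_pos_iff.1 hr).1.ne' hq, one_div,
    ENNReal.rpow_inv_le_iff hr]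
  simp_rw [enorm_eq_self, hsup]
  rw [lintegral_iSup (f := fun (n : ℕ) ω => min (V ω) n ^ q.toReal) (fun n => by fun_prop)
    fun a b hab ω => ENNReal.rpow_le_rpow (min_le_min_left _ (by exact_mod_cast hab)) hr.le]
  exact iSup_le htrunc

theorem indicatorConstLp_add {s : Set Ω} (hs : MeasurableSet s) (hμs : μ s ≠ ∞) (a b : E) :
    indicatorConstLp p hs hμs (a + b) =
      indicatorConstLp p hs hμs a + indicatorConstLp p hs hμs b := by
  ext1
  grw [Lp.coeFn_add, indicatorConstLp_coeFn, indicatorConstLp_coeFn, indicatorConstLp_coeFn]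
  rw [← indicator_add', Pi.add_def]

theorem indicatorConstLp_smul [NormedSpace ℝ E] {s : Set Ω} (hs : MeasurableSet s)
    (hμs : μ s ≠ ∞) (a : ℝ) (b : E) :
    indicatorConstLp p hs hμs (a • b) = a • indicatorConstLp p hs hμs b := by
  ext1
  grw [Lp.coeFn_smul, indicatorConstLp_coeFn, indicatorConstLp_coeFn]
  exact (indicator_const_smul s a _).eventuallyEq

theorem indicatorConstLp_biUnion_finset {ι : Type*} {f : ι → Set Ω} (t : Finset ι)
    (hf : ∀ i, MeasurableSet (f i)) (hμf : ∀ i, μ (f i) ≠ ∞) (hd : Pairwise (Disjoint on f))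
    (hμt : μ (⋃ i ∈ t, f i) ≠ ∞) (c : E) :
    indicatorConstLp p (t.measurableSet_biUnion fun i _ => hf i) hμt c =
      ∑ i ∈ t, indicatorConstLp p (hf i) (hμf i) c := by
  ext1
  have hae : ∀ᵐ ω ∂μ, ∀ i ∈ t, indicatorConstLp p (hf i) (hμf i) c ω =
      (f i).indicator (fun _ => c) ω :=
    (Finset.eventually_all t).2 fun i _ => indicatorConstLp_coeFn
  filter_upwards [hae, indicatorConstLp_coeFn
    (hs := t.measurableSet_biUnion fun i _ => hf i) (hμs := hμt) (c := c) (p := p),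
    Lp.coeFn_finsetSum t fun i => indicatorConstLp p (hf i) (hμf i) c] with ω h1 h2 h3
  rw [h2, h3, Finset.sum_apply, Finset.sum_congr rfl h1,
    Finset.indicator_biUnion_apply t f fun i _ j _ hij => hd hij]

variable [Fact (1 ≤ p)]

theorem hasSum_indicatorConstLp [IsFiniteMeasure μ] (hp : p ≠ ∞) {f : ℕ → Set Ω}
    (hf : ∀ i, MeasurableSet (f i)) (hd : Pairwise (Disjoint on f)) (c : E) :
    HasSum (fun i => indicatorConstLp p (hf i) (measure_ne_top μ _) c)
      (indicatorConstLp p (MeasurableSet.iUnion hf) (measure_ne_top μ _) c) := by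
  simp_rw [HasSum, ← indicatorConstLp_biUnion_finset _ hf (fun _ => measure_ne_top μ _) hd
    (measure_ne_top μ _) c]
  refine tendsto_indicatorConstLp_set hp ?_
  have htail := ENNReal.tendsto_tsum_compl_atTop_zero (f := fun i => μ (f i))
    (measure_iUnion hd hf ▸ measure_ne_top μ _)
  refine tendsto_of_tendsto_of_tendsto_of_le_of_le tendsto_const_nhds htail
    (fun _ => zero_le) fun t => ?_
  refine (measure_mono fun ω hω => ?_).trans (measure_iUnion_le fun i : {i // i ∉ t} => f i)
  rw [symmDiff_of_le (iUnion₂_subset fun i _ => subset_iUnion f i)] at hω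
  obtain ⟨i, hi⟩ := mem_iUnion.1 hω.1
  exact mem_iUnion.2 ⟨⟨i, fun hit => hω.2 (mem_biUnion hit hi)⟩, hi⟩

theorem clm_ext_indicatorConstLp [IsFiniteMeasure μ] [NormedSpace ℝ E] [NormedSpace ℝ F]
    (hp : p ≠ ∞) {φ ψ : Lp E p μ →L[ℝ] F}
    (h : ∀ s (hs : MeasurableSet s) c, φ (indicatorConstLp p hs (measure_ne_top μ s) c) =
      ψ (indicatorConstLp p hs (measure_ne_top μ s) c)) : φ = ψ := by
  ext f
  refine Lp.induction hp (fun f => φ f = ψ f) (fun c s hs hμs => ?_) (fun f g _ _ _ h1 h2 => ?_)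
    (isClosed_eq φ.continuous ψ.continuous) f
  · rw [Lp.simpleFunc.coe_indicatorConst]
    exact h s hs c
  · rw [map_add, map_add, h1, h2]

open Classical in
/-- The signed measure `s ↦ φ 1_s` of a continuous functional `φ` on `Lᵖ`, `p < ∞`; its density
represents `φ`. -/
noncomputable def functionalMeasure [IsFiniteMeasure μ] (hp : p ≠ ∞) (φ : Lp ℝ p μ →L[ℝ] ℝ) :
    SignedMeasure Ω where
  measureOf' s := if hs : MeasurableSet s then
    φ (indicatorConstLp p hs (measure_ne_top μ s) 1) else 0
  empty' := by simp
  not_measurable' s hs := dif_neg hs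
  m_iUnion' f hf hd := by
    simp only [hf, MeasurableSet.iUnion hf, dite_true]
    exact (hasSum_indicatorConstLp hp hf hd 1).mapL φ

theorem functionalMeasure_apply [IsFiniteMeasure μ] (hp : p ≠ ∞) (φ : Lp ℝ p μ →L[ℝ] ℝ)
    {s : Set Ω} (hs : MeasurableSet s) :
    functionalMeasure hp φ s = φ (indicatorConstLp p hs (measure_ne_top μ s) 1) :=
  dif_pos hs

theorem functionalMeasure_absolutelyContinuous [IsFiniteMeasure μ] (hp : p ≠ ∞)
    (φ : Lp ℝ p μ →L[ℝ] ℝ) : functionalMeasure hp φ ≪ᵥ μ.toENNRealVectorMeasure := by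
  refine VectorMeasure.AbsolutelyContinuous.mk fun s hs h0 => ?_
  rw [Measure.toENNRealVectorMeasure_apply_measurable hs] at h0
  have hzero : indicatorConstLp p hs (measure_ne_top μ s) (1 : ℝ) = 0 :=
    (Lp.eq_zero_iff_ae_eq_zero).2 (indicatorConstLp_coeFn.trans (indicator_meas_zero h0))
  rw [functionalMeasure_apply hp φ hs, hzero, map_zero]

theorem exists_integrable_setIntegral_eq [IsFiniteMeasure μ] (hp : p ≠ ∞)
    (φ : Lp ℝ p μ →L[ℝ] ℝ) :
    ∃ V : Ω → ℝ, Measurable V ∧ Integrable V μ ∧ ∀ s (hs : MeasurableSet s),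
      φ (indicatorConstLp p hs (measure_ne_top μ s) 1) = ∫ ω in s, V ω ∂μ := by
  refine ⟨(functionalMeasure hp φ).rnDeriv μ, SignedMeasure.measurable_rnDeriv _ _,
    SignedMeasure.integrable_rnDeriv _ _, fun s hs => ?_⟩
  rw [← withDensityᵥ_apply (SignedMeasure.integrable_rnDeriv _ _) hs,
    SignedMeasure.withDensityᵥ_rnDeriv_eq _ _ (functionalMeasure_absolutelyContinuous hp φ),
    functionalMeasure_apply hp φ hs]

theorem apply_toLp_simpleFunc_eq_integral [IsFiniteMeasure μ] {φ : Lp ℝ p μ →L[ℝ] ℝ} {V : Ω → ℝ}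
    (hV : Integrable V μ) (hφ : ∀ s (hs : MeasurableSet s),
      φ (indicatorConstLp p hs (measure_ne_top μ s) 1) = ∫ ω in s, V ω ∂μ)
    (g : SimpleFunc Ω ℝ) :
    φ ((g.memLp_of_isFiniteMeasure p μ).toLp g) = ∫ ω, V ω * g ω ∂μ := by
  induction g using SimpleFunc.induction with
  | @const c s hs =>
    have h1 : ∀ h, MemLp.toLp (p := p) (μ := μ) ⇑(SimpleFunc.piecewise s hs (SimpleFunc.const Ω c)
        (SimpleFunc.const Ω 0)) h = c • indicatorConstLp p hs (measure_ne_top μ s) 1 := by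
      intro h
      rw [← indicatorConstLp_smul, smul_eq_mul, mul_one]
      exact MemLp.toLp_congr _ _ (.of_forall fun ω => by
        by_cases hω : ω ∈ s <;> simp [hω])
    rw [h1, map_smul, hφ, ← integral_indicator hs, smul_eq_mul, ← integral_const_mul]
    exact integral_congr_ae (.of_forall fun ω => by
      by_cases hω : ω ∈ s <;> simp [hω, mul_comm])
  | @add f g _ hf hg =>
    have hint : ∀ f : SimpleFunc Ω ℝ, Integrable (fun ω => V ω * f ω) μ := fun f =>
      hV.mul_of_top_left (f.memLp_of_isFiniteMeasure ∞ μ)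
    simp only [SimpleFunc.coe_add, Pi.add_apply, mul_add]
    rw [integral_add (hint f) (hint g), ← hf, ← hg, ← map_add]
    rfl

theorem exists_simpleFunc_mul_eq_abs_mul {V : Ω → ℝ} (hV : Measurable V)
    (g : SimpleFunc Ω ℝ≥0) :
    ∃ h : SimpleFunc Ω ℝ, (∀ ω, V ω * h ω = |V ω| * g ω) ∧ ∀ ω, ‖h ω‖ₑ = g ω := by
  let sgn : SimpleFunc Ω ℝ := SimpleFunc.piecewise {ω | 0 ≤ V ω}
    (measurableSet_le measurable_const hV) (SimpleFunc.const Ω 1) (SimpleFunc.const Ω (-1))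
  refine ⟨sgn * g.map ((↑) : ℝ≥0 → ℝ), fun ω => ?_, fun ω => ?_⟩ <;>
    rcases le_or_gt 0 (V ω) with hω | hω
  · simp [sgn, hω, abs_of_nonneg hω]
  · simp [sgn, hω.not_ge, abs_of_neg hω]
  · simp [sgn, hω]
  · simp [sgn, hω.not_ge]

theorem lintegral_enorm_mul_le_of_setIntegral_eq [IsFiniteMeasure μ] {φ : Lp ℝ p μ →L[ℝ] ℝ}
    {V : Ω → ℝ} (hVm : Measurable V) (hV : Integrable V μ)
    (hφ : ∀ s (hs : MeasurableSet s),
      φ (indicatorConstLp p hs (measure_ne_top μ s) 1) = ∫ ω in s, V ω ∂μ)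
    {f : Ω → ℝ≥0∞} (hf : Measurable f) :
    ∫⁻ ω, ‖V ω‖ₑ * f ω ∂μ ≤ ‖φ‖ₑ * eLpNorm f p μ := by
  have hVf : ∫⁻ ω, ‖V ω‖ₑ * f ω ∂μ = ∫⁻ ω, f ω ∂μ.withDensity fun ω => ‖V ω‖ₑ :=
    (lintegral_withDensity_eq_lintegral_mul _ hVm.enorm hf).symm
  rw [hVf, lintegral_eq_nnreal]
  refine iSup₂_le fun g hg => ?_
  obtain ⟨h, hVh, hhg⟩ := exists_simpleFunc_mul_eq_abs_mul hVm g
  have hint : Integrable (fun ω => V ω * h ω) μ :=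
    hV.mul_of_top_left (h.memLp_of_isFiniteMeasure ∞ μ)
  calc (g.map ((↑) : ℝ≥0 → ℝ≥0∞)).lintegral (μ.withDensity fun ω => ‖V ω‖ₑ)
      = ∫⁻ ω, ‖V ω‖ₑ * g ω ∂μ := by
        rw [← SimpleFunc.lintegral_eq_lintegral]
        exact lintegral_withDensity_eq_lintegral_mul _ hVm.enorm (SimpleFunc.measurable _)
    _ = ENNReal.ofReal (∫ ω, V ω * h ω ∂μ) := by
        rw [ofReal_integral_eq_lintegral_ofReal hint (.of_forall fun ω => by
          simp only [hVh]; positivity)]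
        refine lintegral_congr fun ω => ?_
        rw [hVh, ENNReal.ofReal_mul (abs_nonneg _), ENNReal.ofReal_coe_nnreal,
          Real.enorm_eq_ofReal_abs]
    _ = ENNReal.ofReal (φ ((h.memLp_of_isFiniteMeasure p μ).toLp h)) := by
        rw [apply_toLp_simpleFunc_eq_integral hV hφ]
    _ ≤ ‖φ ((h.memLp_of_isFiniteMeasure p μ).toLp h)‖ₑ := Real.ofReal_le_enorm _
    _ ≤ ‖φ‖ₑ * ‖(h.memLp_of_isFiniteMeasure p μ).toLp h‖ₑ := φ.le_opENorm _
    _ ≤ ‖φ‖ₑ * eLpNorm f p μ := by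
        rw [Lp.enorm_toLp]
        gcongr
        exact eLpNorm_mono_enorm fun ω => (hhg ω).trans_le (hg ω)

theorem exists_memLp_setIntegral_eq [IsFiniteMeasure μ] [ENNReal.HolderConjugate p q]
    (hp : p ≠ ∞) (φ : Lp ℝ p μ →L[ℝ] ℝ) :
    ∃ v : Ω → ℝ, MemLp v q μ ∧ ∀ s (hs : MeasurableSet s),
      φ (indicatorConstLp p hs (measure_ne_top μ s) 1) = ∫ ω in s, v ω ∂μ := by
  obtain ⟨V, hVm, hV, hφ⟩ := exists_integrable_setIntegral_eq hp φ
  refine ⟨V, ⟨hVm.aestronglyMeasurable, ?_⟩, hφ⟩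
  rw [← eLpNorm_enorm]
  exact (eLpNorm_le_of_forall_lintegral_mul_le hp hVm.enorm fun f hf =>
    lintegral_enorm_mul_le_of_setIntegral_eq hVm hV hφ hf).trans_lt enorm_lt_top

end Riesz

section Pairing

open Filter Topology

variable {Ω : Type*} {mΩ : MeasurableSpace Ω} {μ : Measure Ω} {d : ℕ} {p q : ℝ≥0∞}

/-- The dot product of `ℝᵈ` as a continuous bilinear map, as needed for Hölder's inequality. -/
noncomputable def dotL (d : ℕ) : (Fin d → ℝ) →L[ℝ] (Fin d → ℝ) →L[ℝ] ℝ :=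
  ∑ i, (ContinuousLinearMap.mul ℝ ℝ).bilinearComp (ContinuousLinearMap.proj i)
    (ContinuousLinearMap.proj i)

theorem dotL_apply (x y : Fin d → ℝ) : dotL d x y = x ⬝ᵥ y := by
  simp [dotL, dotProduct]

theorem integrable_dotProduct [ENNReal.HolderConjugate p q] {v Z : Ω → Fin d → ℝ}
    (hv : MemLp v q μ) (hZ : MemLp Z p μ) : Integrable (fun ω => v ω ⬝ᵥ Z ω) μ := by
  have : ENNReal.HolderConjugate q p := ENNReal.HolderConjugate.symm
  simpa only [dotL_apply, memLp_one_iff_integrable] using (dotL d).memLp_of_bilin 1 hv hZ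

variable [Fact (1 ≤ p)] [ENNReal.HolderConjugate p q]

variable (p) in
/-- The continuous functional `Z ↦ E[vᵀZ]` on `Lᵖ` given by `v ∈ L^q`. -/
noncomputable def pairing (v : Lp (Fin d → ℝ) q μ) : StrongDual ℝ (Lp (Fin d → ℝ) p μ) :=
  haveI : ENNReal.HolderConjugate q p := ENNReal.HolderConjugate.symm
  haveI : Fact (1 ≤ q) := ⟨ENNReal.HolderConjugate.one_le q p⟩
  (dotL d).lpPairing μ q p v

theorem pairing_apply (v : Lp (Fin d → ℝ) q μ) (Z : Lp (Fin d → ℝ) p μ) :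
    pairing p v Z = ∫ ω, v ω ⬝ᵥ Z ω ∂μ := by
  simp only [pairing, ContinuousLinearMap.lpPairing_eq_integral, dotL_apply]

theorem pairing_comm [Fact (1 ≤ q)] [ENNReal.HolderConjugate q p] (v : Lp (Fin d → ℝ) q μ)
    (u : Lp (Fin d → ℝ) p μ) : pairing p v u = pairing q u v := by
  simp only [pairing_apply, dotProduct_comm]

theorem pairing_indicatorConstLp (v : Lp (Fin d → ℝ) q μ) {s : Set Ω} (hs : MeasurableSet s)
    (hμs : μ s ≠ ∞) (c : Fin d → ℝ) :
    pairing p v (indicatorConstLp p hs hμs c) = ∫ ω in s, v ω ⬝ᵥ c ∂μ := by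
  rw [pairing_apply, ← integral_indicator hs]
  refine integral_congr_ae ?_
  filter_upwards [indicatorConstLp_coeFn (p := p) (hs := hs) (hμs := hμs) (c := c)] with ω hω
  rw [hω]
  by_cases h : ω ∈ s <;> simp [h]

theorem exists_eq_pairing [IsFiniteMeasure μ] (hp : p ≠ ∞)
    (φ : StrongDual ℝ (Lp (Fin d → ℝ) p μ)) :
    ∃ v : Lp (Fin d → ℝ) q μ, φ = pairing p v := by
  let J (i : Fin d) : Lp ℝ p μ →L[ℝ] Lp (Fin d → ℝ) p μ :=
    (ContinuousLinearMap.single ℝ (fun _ : Fin d => ℝ) i).compLpL p μ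
  choose v hv hφ using fun i => exists_memLp_setIntegral_eq (q := q) hp (φ.comp (J i))
  have hvLp : MemLp (fun ω i => v i ω) q μ := memLp_pi_iff.2 hv
  refine ⟨hvLp.toLp, clm_ext_indicatorConstLp hp fun s hs c => ?_⟩
  have hJ (i : Fin d) : J i (indicatorConstLp p hs (measure_ne_top μ s) 1) =
      indicatorConstLp p hs (measure_ne_top μ s) (Pi.single i 1) := by
    ext1
    grw [ContinuousLinearMap.coeFn_compLpL, indicatorConstLp_coeFn]
    filter_upwards [indicatorConstLp_coeFn (p := p) (hs := hs) (hμs := measure_ne_top μ s)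
      (c := (1 : ℝ))] with ω hω
    rw [hω]
    by_cases h : ω ∈ s <;> simp [h]
  have hc : indicatorConstLp p hs (measure_ne_top μ s) c =
      ∑ i, c i • indicatorConstLp p hs (measure_ne_top μ s) (Pi.single i 1) := by
    let I : (Fin d → ℝ) →ₗ[ℝ] Lp (Fin d → ℝ) p μ :=
      { toFun := indicatorConstLp p hs (measure_ne_top μ s)
        map_add' := indicatorConstLp_add hs (measure_ne_top μ s)
        map_smul' := fun a b => indicatorConstLp_smul hs (measure_ne_top μ s) a b }
    simpa [I] using (congrArg I ((Pi.basisFun ℝ (Fin d)).sum_repr c)).symm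
  calc φ (indicatorConstLp p hs (measure_ne_top μ s) c)
      = ∑ i, c i * ∫ ω in s, v i ω ∂μ := by
        simp only [hc, map_sum, map_smul, smul_eq_mul, ← hJ]
        exact Finset.sum_congr rfl fun i _ => congrArg _ (hφ i s hs)
    _ = ∫ ω in s, (fun i => v i ω) ⬝ᵥ c ∂μ := by
        simp only [dotProduct]
        rw [integral_finsetSum _ fun i _ => (((hv i).integrable
          (ENNReal.HolderConjugate.one_le q p)).mul_const _).integrableOn]
        simp only [integral_mul_const, mul_comm]
    _ = pairing p hvLp.toLp (indicatorConstLp p hs (measure_ne_top μ s) c) := by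
        rw [pairing_indicatorConstLp]
        refine setIntegral_congr_ae hs ?_
        filter_upwards [hvLp.coeFn_toLp] with ω hω _
        rw [hω]

theorem lpTopology_top : lpTopology (d := d) ∞ μ = TopologicalSpace.induced
    (fun (X : Lp (Fin d → ℝ) ∞ μ) (Y : Lp (Fin d → ℝ) 1 μ) => pairing ∞ Y X)
      Pi.topologicalSpace := by
  simp_rw [lpTopology, if_pos, pairing_apply]

theorem lpTopology_of_ne_top (hp : p ≠ ∞) :
    lpTopology (d := d) p μ = (inferInstance : TopologicalSpace (Lp (Fin d → ℝ) p μ)) :=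
  if_neg hp

theorem continuous_lpTopology_pairing (v : Lp (Fin d → ℝ) q μ) :
    @Continuous _ _ (lpTopology p μ) _ (pairing p v) := by
  by_cases hp : p = ∞
  · subst hp
    obtain rfl : q = 1 := ENNReal.HolderConjugate.unique ∞ q 1
    rw [lpTopology_top]
    let F (X : Lp (Fin d → ℝ) ∞ μ) (Y : Lp (Fin d → ℝ) 1 μ) : ℝ := pairing ∞ Y X
    let : TopologicalSpace (Lp (Fin d → ℝ) ∞ μ) := .induced F Pi.topologicalSpace
    exact continuous_pi_iff.1 (continuous_induced_dom (f := F)) v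
  · rw [lpTopology_of_ne_top hp]
    exact (pairing p v).continuous

theorem norm_topology_le_lpTopology :
    (inferInstance : TopologicalSpace (Lp (Fin d → ℝ) p μ)) ≤ lpTopology p μ := by
  by_cases hp : p = ∞
  · subst hp
    rw [lpTopology_top, ← continuous_iff_le_induced]
    exact continuous_pi fun Y => (pairing ∞ Y).continuous
  · exact (lpTopology_of_ne_top hp).ge

theorem exists_strongDual_of_notMem_cone {E : Type*} [AddCommGroup E] [Module ℝ E]
    [TopologicalSpace E] [IsTopologicalAddGroup E] [ContinuousSMul ℝ E] [LocallyConvexSpace ℝ E]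
    {B : Set E} (hconv : Convex ℝ B) (hclosed : IsClosed B) (h0 : (0 : E) ∈ B)
    (hsmul : ∀ c : ℝ, 0 < c → ∀ Z ∈ B, c • Z ∈ B) {z : E} (hz : z ∉ B) :
    ∃ f : StrongDual ℝ E, (∀ Z ∈ B, 0 ≤ f Z) ∧ f z < 0 := by
  obtain ⟨f, u, hfz, hfB⟩ := geometric_hahn_banach_point_closed hconv hclosed hz
  have hu : u < 0 := by simpa only [map_zero] using hfB 0 h0
  refine ⟨f, fun Z hZ => ?_, hfz.trans hu⟩
  by_contra! hneg
  have hscaled := hfB _ (hsmul (u / f Z) (div_pos_of_neg_of_neg hu hneg) Z hZ)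
  rw [map_smul, smul_eq_mul, div_mul_cancel₀ _ hneg.ne] at hscaled
  exact lt_irrefl _ hscaled

theorem exists_pairing_of_notMem_cone [IsFiniteMeasure μ] {B : Set (Lp (Fin d → ℝ) p μ)}
    (hconv : Convex ℝ B) (hclosed : @IsClosed _ (lpTopology p μ) B) (h0 : 0 ∈ B)
    (hsmul : ∀ c : ℝ, 0 < c → ∀ Z ∈ B, c • Z ∈ B) {z : Lp (Fin d → ℝ) p μ} (hz : z ∉ B) :
    ∃ v : Lp (Fin d → ℝ) q μ, (∀ Z ∈ B, 0 ≤ pairing p v Z) ∧ pairing p v z < 0 := by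
  by_cases hp : p = ∞
  · subst hp
    obtain rfl : q = 1 := ENNReal.HolderConjugate.unique ∞ q 1
    have : ENNReal.HolderConjugate 1 ∞ := ENNReal.HolderConjugate.symm
    let b : Lp (Fin d → ℝ) ∞ μ →ₗ[ℝ] Lp (Fin d → ℝ) 1 μ →ₗ[ℝ] ℝ :=
      LinearMap.mk₂ ℝ (fun X Y => pairing ∞ Y X) (fun _ _ _ => map_add _ _ _)
        (fun _ _ _ => map_smul _ _ _) (fun X Y Y' => by simp [pairing])
        (fun c X Y => by simp [pairing])
    -- `σ(L^∞, L¹)` is the weak topology of the pairing `b`, whose dual is `L¹`.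
    have hweak : IsClosed (X := WeakBilin b) B := by rwa [lpTopology_top] at hclosed
    obtain ⟨f, hfB, hfz⟩ := exists_strongDual_of_notMem_cone (E := WeakBilin b)
      (B := B) hconv hweak h0 hsmul hz
    obtain ⟨v, rfl⟩ := b.dualEmbedding_surjective f
    exact ⟨v, hfB, hfz⟩
  · obtain ⟨f, hfB, hfz⟩ := exists_strongDual_of_notMem_cone hconv
      (hclosed.mono norm_topology_le_lpTopology) h0 hsmul hz
    obtain ⟨v, rfl⟩ := exists_eq_pairing (q := q) hp f
    exact ⟨v, hfB, hfz⟩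

theorem ae_nonneg_of_forall_pairing_nonneg [IsFiniteMeasure μ] {v : Lp (Fin d → ℝ) q μ}
    (hv : ∀ Z : Lp (Fin d → ℝ) p μ, (∀ᵐ ω ∂μ, 0 ≤ Z ω) → 0 ≤ pairing p v Z) :
    ∀ᵐ ω ∂μ, 0 ≤ v ω := by
  have hq : 1 ≤ q := ENNReal.HolderConjugate.one_le q p
  suffices ∀ i : Fin d, 0 ≤ᵐ[μ] fun ω => v ω i by
    filter_upwards [ae_all_iff.2 this] with ω hω using hω
  refine fun i => ae_nonneg_of_forall_setIntegral_nonneg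
    (((Lp.memLp v).eval i).integrable hq) fun s hs _ => ?_
  have hs0 := hv (indicatorConstLp p hs (measure_ne_top μ s) (Pi.single i 1)) (by
    filter_upwards [indicatorConstLp_coeFn (p := p) (hs := hs) (hμs := measure_ne_top μ s)
      (c := (Pi.single i 1 : Fin d → ℝ))] with ω hω
    rw [hω]
    exact indicator_nonneg (fun _ _ => Pi.single_nonneg.2 zero_le_one) ω)
  simpa only [pairing_indicatorConstLp, dotProduct_single_one] using hs0

theorem eq_zero_of_forall_pairing_eq_zero [IsFiniteMeasure μ]
    {v : Lp (Fin d → ℝ) q μ} (h : ∀ u : Lp (Fin d → ℝ) p μ, pairing p v u = 0) : v = 0 := by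
  have hneg (u : Lp (Fin d → ℝ) p μ) : pairing p (-v) u = 0 := by
    simpa [pairing] using h u
  refine (Lp.eq_zero_iff_ae_eq_zero).2 ?_
  filter_upwards [ae_nonneg_of_forall_pairing_nonneg fun u _ => (h u).ge,
    ae_nonneg_of_forall_pairing_nonneg fun u _ => (hneg u).ge, Lp.coeFn_neg v] with ω hpos hneg hω
  rw [hω, Pi.neg_apply, neg_nonneg] at hneg
  exact le_antisymm hneg hpos

end Pairing

section CondExp

variable {Ω : Type*} {m mΩ : MeasurableSpace Ω} {μ : Measure Ω} [IsFiniteMeasure μ]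

theorem condLExp_mul_of_measurable_left (hm : m ≤ mΩ) {g : Ω → ℝ≥0∞} (hg : AEMeasurable g μ)
    {a : Ω → ℝ≥0∞} (ha : Measurable[m] a) :
    condLExp m μ (fun ω => a ω * g ω) =ᵐ[μ] fun ω => a ω * condLExp m μ g ω := by
  have htrim : (μ.withDensity (condLExp m μ g)).trim hm = (μ.withDensity g).trim hm := by
    refine @Measure.ext _ m _ _ fun s hs => ?_
    rw [trim_measurableSet_eq hm hs, trim_measurableSet_eq hm hs, withDensity_apply _ (hm s hs),
      withDensity_apply _ (hm s hs), setLIntegral_condLExp hm μ g hs]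
  have hdensity {h : Ω → ℝ≥0∞} (hh : AEMeasurable h μ) {s : Set Ω} (hs : MeasurableSet[m] s) :
      ∫⁻ ω in s, a ω * h ω ∂μ = ∫⁻ ω, s.indicator a ω ∂(μ.withDensity h).trim hm := by
    rw [lintegral_trim hm (ha.indicator hs), lintegral_withDensity_eq_lintegral_mul₀ hh
      ((ha.indicator hs).mono hm le_rfl).aemeasurable, ← lintegral_indicator (hm s hs)]
    refine lintegral_congr fun ω => ?_
    simp only [Pi.mul_apply, mul_comm (h ω), indicator_mul_left]
  refine (ae_eq_condLExp hm μ _ (ha.mul (measurable_condLExp m μ g)) fun s hs => ?_).symm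
  exact (hdensity ((measurable_condLExp m μ g).mono hm le_rfl).aemeasurable hs).trans
    (htrim ▸ (hdensity hg hs).symm)

theorem mul_genCondExp_ae_eq (hm : m ≤ mΩ) {a f : Ω → ℝ} (ha : AEStronglyMeasurable[m] a μ)
    (ha0 : 0 ≤ᵐ[μ] a) (hf : AEStronglyMeasurable f μ) (haf : Integrable (fun ω => a ω * f ω) μ) :
    (fun ω => a ω * genCondExp m μ f ω) =ᵐ[μ] μ[fun ω => a ω * f ω | m] := by
  obtain ⟨b, hb, hab⟩ := ha
  have hpull {g : Ω → ℝ} (hg : AEStronglyMeasurable g μ) :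
      condLExp m μ (fun ω => ENNReal.ofReal (a ω * g ω)) =ᵐ[μ]
        fun ω => ENNReal.ofReal (a ω) * condLExp m μ (fun ω => ENNReal.ofReal (g ω)) ω := by
    have hbg : (fun ω => ENNReal.ofReal (a ω * g ω)) =ᵐ[μ]
        fun ω => ENNReal.ofReal (b ω) * ENNReal.ofReal (g ω) := by
      filter_upwards [hab, ha0] with ω hω hω0
      rw [ENNReal.ofReal_mul hω0, hω]
    refine (condLExp_congr_ae hbg).trans ((condLExp_mul_of_measurable_left hm
      hg.aemeasurable.ennreal_ofReal hb.measurable.ennreal_ofReal).trans ?_)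
    filter_upwards [hab] with ω hω
    rw [hω]
  refine Filter.EventuallyEq.trans ?_ (genCondExp_eq_condExp m μ haf)
  filter_upwards [hpull hf, hpull hf.neg, ha0] with ω hpos hneg hω0
  simp only [Pi.neg_apply, mul_neg] at hneg
  simp only [genCondExp, hpos, hneg, ENNReal.toReal_mul, ENNReal.toReal_ofReal hω0]
  ring

end CondExp

section CondExpVector

variable {Ω : Type*} {m mΩ : MeasurableSpace Ω} {μ : Measure Ω} {d : ℕ} {p q : ℝ≥0∞}

theorem ae_condExp_apply {v : Ω → Fin d → ℝ} (hv : Integrable v μ) :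
    ∀ᵐ ω ∂μ, ∀ i, μ[v | m] ω i = μ[fun ω => v ω i | m] ω :=
  ae_all_iff.2 fun i => (ContinuousLinearMap.proj (R := ℝ) i).comp_condExp_comm hv

theorem ae_condExp_nonneg {v : Ω → Fin d → ℝ} (hv : Integrable v μ)
    (hv0 : ∀ᵐ ω ∂μ, 0 ≤ v ω) : ∀ᵐ ω ∂μ, 0 ≤ μ[v | m] ω := by
  have hcoord (i : Fin d) : 0 ≤ᵐ[μ] μ[fun ω => v ω i | m] :=
    condExp_nonneg (hv0.mono fun ω hω => hω i)
  filter_upwards [ae_condExp_apply hv, ae_all_iff.2 hcoord] with ω hω hω0 i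
  exact (hω0 i).trans_eq (hω i).symm

theorem condExp_dotProduct_of_aestronglyMeasurable_right [ENNReal.HolderConjugate p q]
    [IsFiniteMeasure μ] {v u : Ω → Fin d → ℝ} (hv : MemLp v q μ) (hu : MemLp u p μ)
    (hum : AEStronglyMeasurable[m] u μ) :
    μ[fun ω => v ω ⬝ᵥ u ω | m] =ᵐ[μ] fun ω => μ[v | m] ω ⬝ᵥ u ω := by
  have hvu := integrable_dotProduct hv hu
  simp only [← dotL_apply] at hvu ⊢
  exact condExp_bilin_of_aestronglyMeasurable_right (dotL d) hum hvu
    (hv.integrable (ENNReal.HolderConjugate.one_le q p))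

end CondExpVector

section PosQuotient

variable {Ω : Type*} {m mΩ : MeasurableSpace Ω} {μ : Measure Ω} {f g : Ω → ℝ}

/-- The quotient `f / g`, set to `1` where `g` is not positive; this is the convention in `xi`. -/
noncomputable def posQuotient (f g : Ω → ℝ) : Ω → ℝ := fun ω =>
  open Classical in if 0 < g ω then f ω / g ω else 1

theorem posQuotient_nonneg {ω : Ω} (hf : 0 ≤ f ω) : 0 ≤ posQuotient f g ω := by
  unfold posQuotient
  split_ifs with h
  exacts [div_nonneg hf h.le, zero_le_one]

theorem aestronglyMeasurable_posQuotient (hf : AEStronglyMeasurable f μ) (hg : Measurable g) :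
    AEStronglyMeasurable (posQuotient f g) μ := by
  refine ⟨posQuotient (hf.mk f) g, (Measurable.ite (measurableSet_lt measurable_const hg)
    (hf.stronglyMeasurable_mk.measurable.div hg) measurable_const).stronglyMeasurable, ?_⟩
  filter_upwards [hf.ae_eq_mk] with ω hω
  simp only [posQuotient, hω]

variable [IsFiniteMeasure μ]

theorem mul_posQuotient_ae_eq (hm : m ≤ mΩ) (hfi : Integrable f μ) (hf0 : 0 ≤ᵐ[μ] f)
    (hg : Measurable[m] g) (hfg : g =ᵐ[μ] μ[f | m]) :
    (fun ω => g ω * posQuotient f g ω) =ᵐ[μ] f := by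
  have hs : MeasurableSet[m] {ω | g ω ≤ 0} := hg measurableSet_Iic
  have hint : ∫ ω in {ω | g ω ≤ 0}, f ω ∂μ = 0 := by
    refine le_antisymm ?_ (integral_nonneg_of_ae (ae_restrict_of_ae hf0))
    rw [← setIntegral_condExp hm hfi hs]
    refine setIntegral_nonpos_of_ae_restrict ?_
    filter_upwards [ae_restrict_of_ae hfg, ae_restrict_mem (hm _ hs)] with ω hω hωs
    exact hω ▸ hωs
  rw [setIntegral_eq_zero_iff_of_nonneg_ae (ae_restrict_of_ae hf0) hfi.integrableOn,
    Filter.EventuallyEq, ae_restrict_iff' (hm _ hs)] at hint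
  filter_upwards [hint, (condExp_nonneg hf0).trans hfg.symm.le] with ω hω hω0
  unfold posQuotient
  split_ifs with h
  · exact mul_div_cancel₀ _ h.ne'
  · rw [hω (not_lt.1 h), le_antisymm (not_lt.1 h) hω0]
    exact zero_mul _

theorem condLExp_ofReal_posQuotient (hm : m ≤ mΩ) (hfi : Integrable f μ) (hf0 : 0 ≤ᵐ[μ] f)
    (hg : Measurable[m] g) (hfg : g =ᵐ[μ] μ[f | m]) :
    condLExp m μ (fun ω => ENNReal.ofReal (posQuotient f g ω)) =ᵐ[μ] fun _ => 1 := by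
  let r : Ω → ℝ≥0∞ := fun ω => ENNReal.ofReal (posQuotient f g ω)
  have hr : AEMeasurable r μ :=
    (aestronglyMeasurable_posQuotient hfi.1 (hg.mono hm le_rfl)).aemeasurable.ennreal_ofReal
  have hpos : (fun ω => ENNReal.ofReal (g ω) * condLExp m μ r ω) =ᵐ[μ]
      fun ω => ENNReal.ofReal (g ω) := by
    have hgr : (fun ω => ENNReal.ofReal (g ω) * r ω) =ᵐ[μ] fun ω => ENNReal.ofReal (f ω) := by
      filter_upwards [mul_posQuotient_ae_eq hm hfi hf0 hg hfg, hf0] with ω hω hω0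
      rw [← hω, ENNReal.ofReal_mul' (posQuotient_nonneg hω0)]
    filter_upwards [condLExp_mul_of_measurable_left hm hr hg.ennreal_ofReal,
      condLExp_congr_ae hgr (mΩ := m), condLExp_ofReal m hfi hf0, hfg] with ω h₁ h₂ h₃ h₄
    rw [← h₁, h₂, h₃, h₄]
  have hnonpos : (fun ω => {ω | g ω ≤ 0}.indicator 1 ω * condLExp m μ r ω) =ᵐ[μ]
      {ω | g ω ≤ 0}.indicator 1 := by
    have hs : Measurable[m] ({ω | g ω ≤ 0}.indicator (1 : Ω → ℝ≥0∞)) :=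
      (@measurable_const _ _ _ m 1).indicator (hg measurableSet_Iic)
    have hone : (fun ω => {ω | g ω ≤ 0}.indicator 1 ω * r ω) = {ω | g ω ≤ 0}.indicator 1 := by
      funext ω
      by_cases h : g ω ≤ 0 <;> simp [r, posQuotient, h]
    have h := condLExp_mul_of_measurable_left hm hr hs
    rw [hone, condLExp_eq_self hm μ hs] at h
    exact h.symm
  filter_upwards [hpos, hnonpos] with ω h₁ h₂
  rcases le_or_gt (g ω) 0 with h | h
  · simpa [h] using h₂
  · exact (ENNReal.mul_right_inj (ENNReal.ofReal_pos.2 h).ne' ENNReal.ofReal_ne_top).1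
      (h₁.trans (mul_one _).symm)

theorem lintegral_ofReal_posQuotient (hm : m ≤ mΩ) (hfi : Integrable f μ) (hf0 : 0 ≤ᵐ[μ] f)
    (hg : Measurable[m] g) (hfg : g =ᵐ[μ] μ[f | m]) :
    ∫⁻ ω, ENNReal.ofReal (posQuotient f g ω) ∂μ = μ univ := by
  rw [← lintegral_condLExp hm, lintegral_congr_ae (condLExp_ofReal_posQuotient hm hfi hf0 hg hfg),
    lintegral_one]

theorem integrable_posQuotient (hm : m ≤ mΩ) (hfi : Integrable f μ) (hf0 : 0 ≤ᵐ[μ] f)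
    (hg : Measurable[m] g) (hfg : g =ᵐ[μ] μ[f | m]) : Integrable (posQuotient f g) μ := by
  refine ⟨aestronglyMeasurable_posQuotient hfi.1 (hg.mono hm le_rfl), ?_⟩
  rw [hasFiniteIntegral_iff_ofReal (hf0.mono fun _ => posQuotient_nonneg),
    lintegral_ofReal_posQuotient hm hfi hf0 hg hfg]
  exact measure_lt_top μ univ

theorem condExp_posQuotient (hm : m ≤ mΩ) (hfi : Integrable f μ) (hf0 : 0 ≤ᵐ[μ] f)
    (hg : Measurable[m] g) (hfg : g =ᵐ[μ] μ[f | m]) :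
    μ[posQuotient f g | m] =ᵐ[μ] fun _ => 1 := by
  filter_upwards [condLExp_ofReal m (integrable_posQuotient hm hfi hf0 hg hfg)
    (hf0.mono fun _ => posQuotient_nonneg), condLExp_ofReal_posQuotient hm hfi hf0 hg hfg]
    with ω hω hω1
  exact ENNReal.ofReal_eq_one.1 (hω ▸ hω1)

end PosQuotient

section Transport

variable {Ω : Type*} {mΩ : MeasurableSpace Ω} {μ : Measure Ω}
  {ι : Type*} [Preorder ι] {ℱ : Filtration ι mΩ} {t T : ι} {d : ℕ} {p q : ℝ≥0∞}
  {Q : Fin d → Measure Ω} {w : Ω → Fin d → ℝ}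

theorem densityAt_nonneg (s : ι) (ν : Measure Ω) : 0 ≤ᵐ[μ] densityAt ℱ μ s ν :=
  condExp_nonneg (Filter.Eventually.of_forall fun _ => ENNReal.toReal_nonneg)

variable [IsFiniteMeasure μ]

theorem densityAt_ae_eq_condExp (htT : t ≤ T) (ν : Measure Ω) :
    densityAt ℱ μ t ν =ᵐ[μ] μ[densityAt ℱ μ T ν | ℱ t] :=
  (condExp_condExp_of_le (ℱ.mono htT) (ℱ.le T)).symm

theorem integrable_xi (htT : t ≤ T) (ν : Measure Ω) : Integrable (xi ℱ μ t T ν) μ :=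
  integrable_posQuotient (ℱ.le t) integrable_condExp (densityAt_nonneg T ν)
    stronglyMeasurable_condExp.measurable (densityAt_ae_eq_condExp htT ν)

theorem condExp_xi (htT : t ≤ T) (ν : Measure Ω) : μ[xi ℱ μ t T ν | ℱ t] =ᵐ[μ] fun _ => 1 :=
  condExp_posQuotient (ℱ.le t) integrable_condExp (densityAt_nonneg T ν)
    stronglyMeasurable_condExp.measurable (densityAt_ae_eq_condExp htT ν)

theorem condExp_transport (htT : t ≤ T) (hw : AEStronglyMeasurable[ℱ t] w μ)
    (hv : Integrable (transport ℱ μ t T Q w) μ) :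
    μ[transport ℱ μ t T Q w | ℱ t] =ᵐ[μ] w := by
  have hcoord (i : Fin d) : μ[fun ω => transport ℱ μ t T Q w ω i | ℱ t] =ᵐ[μ] fun ω => w ω i := by
    filter_upwards [condExp_mul_of_aestronglyMeasurable_left
      ((continuous_apply i).comp_aestronglyMeasurable hw) (hv.eval i) (integrable_xi htT (Q i)),
      condExp_xi (μ := μ) (ℱ := ℱ) htT (Q i)] with ω hω hω1
    exact hω.trans (by rw [Pi.mul_apply, hω1, mul_one])
  filter_upwards [ae_condExp_apply hv, ae_all_iff.2 hcoord] with ω hω hωi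
  exact funext fun i => (hω i).trans (hωi i)

theorem dotProduct_condExpQ_ae_eq [ENNReal.HolderConjugate p q] (htT : t ≤ T)
    (hw : AEStronglyMeasurable[ℱ t] w μ) (hv : MemLp (transport ℱ μ t T Q w) q μ)
    (hv0 : ∀ᵐ ω ∂μ, 0 ≤ transport ℱ μ t T Q w ω) {Z : Ω → Fin d → ℝ} (hZ : MemLp Z p μ) :
    (fun ω => w ω ⬝ᵥ condExpQ ℱ μ t T Q Z ω) =ᵐ[μ]
      μ[fun ω => transport ℱ μ t T Q w ω ⬝ᵥ Z ω | ℱ t] := by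
  have : ENNReal.HolderConjugate q p := ENNReal.HolderConjugate.symm
  have hvi : Integrable (transport ℱ μ t T Q w) μ :=
    hv.integrable (ENNReal.HolderConjugate.one_le q p)
  have hw0 : ∀ᵐ ω ∂μ, 0 ≤ w ω := by
    filter_upwards [condExp_transport htT hw hvi, ae_condExp_nonneg (m := ℱ t) hvi hv0]
      with ω hω hω0 using hω ▸ hω0
  have hint (i : Fin d) : Integrable (fun ω => transport ℱ μ t T Q w ω i * Z ω i) μ :=
    (hv.eval i).integrable_mul (hZ.eval i)
  have hcoord (i : Fin d) : (fun ω => w ω i * condExpQ ℱ μ t T Q Z ω i) =ᵐ[μ]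
      μ[fun ω => transport ℱ μ t T Q w ω i * Z ω i | ℱ t] := by
    simp only [transport, condExpQ, mul_assoc] at hint ⊢
    exact mul_genCondExp_ae_eq (ℱ.le t) ((continuous_apply i).comp_aestronglyMeasurable hw)
      (hw0.mono fun ω hω => hω i) ((integrable_xi htT (Q i)).1.mul (hZ.eval i).1) (hint i)
  have hsum : (fun ω => transport ℱ μ t T Q w ω ⬝ᵥ Z ω) =
      ∑ i, fun ω => transport ℱ μ t T Q w ω i * Z ω i := by
    simp only [dotProduct, Finset.sum_fn]
  filter_upwards [condExp_finsetSum (s := Finset.univ) (fun i _ => hint i) (ℱ t),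
    ae_all_iff.2 hcoord] with ω hω hωi
  rw [hsum, hω, Finset.sum_apply]
  exact Finset.sum_congr rfl fun i _ => hωi i

theorem exists_isProbabilityMeasure_xi_ae_eq [IsProbabilityMeasure μ] (hT : ℱ T = mΩ)
    {r : Ω → ℝ} (hr : Integrable r μ) (hr0 : 0 ≤ᵐ[μ] r) (hr1 : μ[r | ℱ t] =ᵐ[μ] fun _ => 1) :
    ∃ ν : Measure Ω, IsProbabilityMeasure ν ∧ ν ≪ μ ∧ xi ℱ μ t T ν =ᵐ[μ] r := by
  let ν : Measure Ω := μ.withDensity fun ω => ENNReal.ofReal (r ω)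
  have hdensity : (fun ω => (ν.rnDeriv μ ω).toReal) =ᵐ[μ] r := by
    filter_upwards [Measure.rnDeriv_withDensity₀ μ hr.1.aemeasurable.ennreal_ofReal, hr0]
      with ω hω hω0
    rw [hω, ENNReal.toReal_ofReal hω0]
  have ht : densityAt ℱ μ t ν =ᵐ[μ] fun _ => 1 := (condExp_congr_ae hdensity).trans hr1
  have hTr : densityAt ℱ μ T ν =ᵐ[μ] r :=
    (condExp_congr_ae hdensity).trans
      (condExp_of_aestronglyMeasurable' (ℱ.le T) (by rw [hT]; exact hr.1) hr)
  refine ⟨ν, ⟨?_⟩, withDensity_absolutelyContinuous _ _, ?_⟩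
  · rw [withDensity_apply _ MeasurableSet.univ, setLIntegral_univ,
      ← ofReal_integral_eq_lintegral_ofReal hr hr0, ← integral_condExp (ℱ.le t),
      integral_congr_ae hr1]
    simp
  · filter_upwards [ht, hTr] with ω hω hωr
    simp only [xi, hω, hωr, if_pos one_pos, div_one]

theorem exists_measureVectors_transport_condExp [IsProbabilityMeasure μ] (hT : ℱ T = mΩ)
    {v : Ω → Fin d → ℝ} (hv : Integrable v μ) (hv0 : ∀ᵐ ω ∂μ, 0 ≤ v ω) :
    ∃ Q ∈ measureVectors μ d, transport ℱ μ t T Q μ[v | ℱ t] =ᵐ[μ] v := by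
  have hv0' (i : Fin d) : 0 ≤ᵐ[μ] fun ω => v ω i := hv0.mono fun ω hω => hω i
  have hg (i : Fin d) : Measurable[ℱ t] (μ[fun ω => v ω i | ℱ t]) :=
    stronglyMeasurable_condExp.measurable
  choose Q hQ hQμ hξ using fun i => exists_isProbabilityMeasure_xi_ae_eq (t := t) hT
    (integrable_posQuotient (ℱ.le t) (hv.eval i) (hv0' i) (hg i) .rfl)
    ((hv0' i).mono fun ω hω => posQuotient_nonneg hω)
    (condExp_posQuotient (ℱ.le t) (hv.eval i) (hv0' i) (hg i) .rfl)
  refine ⟨Q, fun i => ⟨hQ i, hQμ i⟩, ?_⟩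
  filter_upwards [ae_all_iff.2 hξ, ae_condExp_apply (m := ℱ t) hv, ae_all_iff.2 fun i =>
    mul_posQuotient_ae_eq (ℱ.le t) (hv.eval i) (hv0' i) (hg i) .rfl] with ω hωξ hω hωv
  funext i
  rw [transport, hωξ i, hω i]
  exact hωv i

end Transport

section Eligible

variable {Ω : Type*} {m mΩ : MeasurableSpace Ω} {μ : Measure Ω} {d : ℕ} {p q : ℝ≥0∞}
  {M : Submodule ℝ (Fin d → ℝ)}

/-- `M^⊥` as a subspace. -/
def perpSubmodule (M : Submodule ℝ (Fin d → ℝ)) : Submodule ℝ (Fin d → ℝ) where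
  carrier := perp M
  add_mem' ha hb u hu := by rw [add_dotProduct, ha u hu, hb u hu, add_zero]
  zero_mem' u _ := zero_dotProduct u
  smul_mem' c a ha u hu := by rw [smul_dotProduct, ha u hu, smul_zero]

theorem perp_perpSubmodule : perp (perpSubmodule M) = M := by
  refine subset_antisymm (fun u hu => ?_) fun u hu v hv => ?_
  · by_contra huM
    obtain ⟨f, hfu, hfM⟩ := M.exists_le_ker_of_notMem huM
    obtain ⟨c, rfl⟩ := (dotProductEquiv ℝ (Fin d)).surjective f
    exact hfu ((dotProduct_comm c u).trans (hu c fun x hx => hfM hx))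
  · rw [dotProduct_comm]
    exact hv u hu

theorem ae_mem_perp {v : Ω → Fin d → ℝ} (h : ∀ c ∈ M, ∀ᵐ ω ∂μ, v ω ⬝ᵥ c = 0) :
    ∀ᵐ ω ∂μ, v ω ∈ perp M := by
  obtain ⟨S, rfl⟩ : M.FG := IsNoetherian.noetherian M
  have hS : ∀ᵐ ω ∂μ, ∀ c ∈ S, v ω ⬝ᵥ c = 0 :=
    (Finset.eventually_all S).2 fun c hc => h c (Submodule.subset_span hc)
  filter_upwards [hS] with ω hω
  have hspan : Submodule.span ℝ (S : Set (Fin d → ℝ)) ≤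
      LinearMap.ker (dotProductEquiv ℝ (Fin d) (v ω)) := Submodule.span_le.2 hω
  exact fun c hc => hspan hc

/-- `M_t` as a subspace of `Lᵖ`. -/
def eligibleSubmodule (m : MeasurableSpace Ω) (p : ℝ≥0∞) (μ : Measure[mΩ] Ω)
    (M : Submodule ℝ (Fin d → ℝ)) : Submodule ℝ (Lp (Fin d → ℝ) p μ) where
  carrier := eligible m p μ M
  add_mem' {u v} hu hv := by
    refine ⟨(hu.1.add hv.1).congr (Lp.coeFn_add u v).symm, ?_⟩
    filter_upwards [hu.2, hv.2, Lp.coeFn_add u v] with ω hω hω' h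
    exact h ▸ M.add_mem hω hω'
  zero_mem' := by
    refine ⟨aestronglyMeasurable_zero.congr (Lp.coeFn_zero _ p μ).symm, ?_⟩
    filter_upwards [Lp.coeFn_zero (Fin d → ℝ) p μ] with ω h
    exact h ▸ M.zero_mem
  smul_mem' c u hu := by
    refine ⟨(hu.1.const_smul c).congr (Lp.coeFn_smul c u).symm, ?_⟩
    filter_upwards [hu.2, Lp.coeFn_smul c u] with ω hω h
    exact h ▸ M.smul_mem c hω

theorem indicatorConstLp_mem_eligible (hm : m ≤ mΩ) {s : Set Ω} (hs : MeasurableSet[m] s)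
    (hμs : μ s ≠ ∞) {c : Fin d → ℝ} (hc : c ∈ M) :
    indicatorConstLp p (hm s hs) hμs c ∈ eligible m p μ M := by
  refine ⟨⟨s.indicator fun _ => c, stronglyMeasurable_const.indicator hs,
    indicatorConstLp_coeFn⟩, ?_⟩
  filter_upwards [indicatorConstLp_coeFn (p := p) (hs := hm s hs) (hμs := hμs) (c := c)]
    with ω hω
  rw [hω]
  by_cases h : ω ∈ s <;> simp [h, hc, M.zero_mem]

variable [IsFiniteMeasure μ] [Fact (1 ≤ p)] [ENNReal.HolderConjugate p q]

theorem pairing_eq_integral_condExp_dotProduct (hm : m ≤ mΩ) (v : Lp (Fin d → ℝ) q μ)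
    {u : Lp (Fin d → ℝ) p μ} (hu : AEStronglyMeasurable[m] u μ) :
    pairing p v u = ∫ ω, μ[v | m] ω ⬝ᵥ u ω ∂μ := by
  rw [pairing_apply, ← integral_condExp hm]
  exact integral_congr_ae
    (condExp_dotProduct_of_aestronglyMeasurable_right (Lp.memLp v) (Lp.memLp u) hu)

theorem forall_eligible_pairing_eq_zero_iff (hm : m ≤ mΩ) {v : Lp (Fin d → ℝ) q μ} :
    (∀ u ∈ eligible m p μ M, pairing p v u = 0) ↔ ∀ᵐ ω ∂μ, μ[v | m] ω ∈ perp M := by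
  refine ⟨fun h => ae_mem_perp fun c hc => ?_, fun h u hu => ?_⟩
  · have hvc : μ[fun ω => v ω ⬝ᵥ c | m] =ᵐ[μ] fun ω => μ[v | m] ω ⬝ᵥ c :=
      condExp_dotProduct_of_aestronglyMeasurable_right (p := p) (Lp.memLp v) (memLp_const c)
        aestronglyMeasurable_const
    have hzero : (fun _ => 0) =ᵐ[μ] μ[fun ω => v ω ⬝ᵥ c | m] := by
      refine ae_eq_condExp_of_forall_setIntegral_eq hm
        (integrable_dotProduct (p := p) (Lp.memLp v) (memLp_const c))
        (fun s _ _ => integrableOn_zero) (fun s hs _ => ?_) aestronglyMeasurable_const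
      rw [integral_zero, ← pairing_indicatorConstLp (p := p) v (hm s hs) (measure_ne_top μ s) c]
      exact (h _ (indicatorConstLp_mem_eligible hm hs (measure_ne_top μ s) hc)).symm
    exact (hzero.trans hvc).symm
  · rw [pairing_eq_integral_condExp_dotProduct hm v hu.1]
    refine integral_eq_zero_of_ae ?_
    filter_upwards [h, hu.2] with ω hω hωu using hω _ hωu

theorem ae_eq_condExp_of_forall_pairing_eq_zero (hm : m ≤ mΩ) {u : Lp (Fin d → ℝ) p μ}
    (h : ∀ v : Lp (Fin d → ℝ) q μ, μ[v | m] =ᵐ[μ] 0 → pairing p v u = 0) :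
    u =ᵐ[μ] μ[u | m] := by
  have : ENNReal.HolderConjugate q p := ENNReal.HolderConjugate.symm
  have hq : 1 ≤ q := ENNReal.HolderConjugate.one_le q p
  have : Fact (1 ≤ q) := ⟨hq⟩
  have hu : MemLp (μ[u | m]) p μ := (Lp.memLp u).condExp Fact.out
  suffices u - hu.toLp = 0 from
    (Lp.ext_iff.1 (sub_eq_zero.1 this)).trans hu.coeFn_toLp
  refine eq_zero_of_forall_pairing_eq_zero (p := q) fun v => ?_
  have hv : MemLp (μ[v | m]) q μ := (Lp.memLp v).condExp hq
  have hv0 : μ[v - hv.toLp | m] =ᵐ[μ] 0 := by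
    refine (condExp_congr_ae (Lp.coeFn_sub v _)).trans ((condExp_sub ((Lp.memLp v).integrable hq)
      ((Lp.memLp _).integrable hq) m).trans ?_)
    filter_upwards [condExp_congr_ae (m := m) hv.coeFn_toLp,
      condExp_condExp_of_le (f := v) le_rfl hm] with ω h₁ h₂
    rw [Pi.sub_apply, h₁, h₂, sub_self, Pi.zero_apply]
  have hvm : AEStronglyMeasurable[m] hv.toLp μ :=
    stronglyMeasurable_condExp.aestronglyMeasurable.congr hv.coeFn_toLp.symm
  have hum : AEStronglyMeasurable[m] hu.toLp μ :=
    stronglyMeasurable_condExp.aestronglyMeasurable.congr hu.coeFn_toLp.symm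
  have hvu : pairing p v u - pairing p hv.toLp u = 0 := by
    simpa [pairing] using h (v - hv.toLp) hv0
  have hvu' : pairing p hv.toLp u = pairing p v hu.toLp := by
    rw [pairing_comm, pairing_eq_integral_condExp_dotProduct hm u hvm,
      pairing_eq_integral_condExp_dotProduct hm v hum]
    refine integral_congr_ae ?_
    filter_upwards [hv.coeFn_toLp, hu.coeFn_toLp] with ω hωv hωu
    rw [hωv, hωu, dotProduct_comm]
  rw [← pairing_comm, map_sub, ← hvu', hvu]

theorem mem_eligible_iff_forall_pairing_eq_zero (hm : m ≤ mΩ) {u : Lp (Fin d → ℝ) p μ} :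
    u ∈ eligible m p μ M ↔ ∀ v : Lp (Fin d → ℝ) q μ,
      (∀ᵐ ω ∂μ, μ[v | m] ω ∈ perp M) → pairing p v u = 0 := by
  refine ⟨fun hu v hv => (forall_eligible_pairing_eq_zero_iff hm).2 hv u hu, fun h => ?_⟩
  have hu : u =ᵐ[μ] μ[u | m] := ae_eq_condExp_of_forall_pairing_eq_zero hm fun v hv =>
    h v (hv.mono fun ω hω => hω ▸ (perpSubmodule M).zero_mem)
  have : ENNReal.HolderConjugate q p := ENNReal.HolderConjugate.symm
  have : Fact (1 ≤ q) := ⟨ENNReal.HolderConjugate.one_le q p⟩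
  have huM : ∀ᵐ ω ∂μ, μ[u | m] ω ∈ perp (perpSubmodule M) := by
    refine (forall_eligible_pairing_eq_zero_iff (p := q) hm).1 fun g hg => ?_
    have hgg : μ[g | m] =ᵐ[μ] g :=
      condExp_of_aestronglyMeasurable' hm hg.1 ((Lp.memLp g).integrable Fact.out)
    rw [← pairing_comm]
    refine h g ?_
    filter_upwards [hgg, hg.2] with ω hω hωg using hω ▸ hωg
  refine ⟨stronglyMeasurable_condExp.aestronglyMeasurable.congr hu.symm, ?_⟩
  filter_upwards [hu, huM] with ω hω hωM
  rwa [hω, ← perp_perpSubmodule]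

theorem isClosed_eligible (hm : m ≤ mΩ) :
    @IsClosed _ (lpTopology p μ) (eligible m p μ M) := by
  let q := ENNReal.conjExponent p
  have : ENNReal.HolderConjugate p q := .conjExponent Fact.out
  have hinter : eligible m p μ M = ⋂ (v : Lp (Fin d → ℝ) q μ)
      (_ : ∀ᵐ ω ∂μ, μ[v | m] ω ∈ perp M), {u | pairing p v u = 0} := by
    ext u
    simp only [mem_eligible_iff_forall_pairing_eq_zero (q := q) hm, mem_iInter, mem_ofPred_eq]
  rw [hinter]
  let := lpTopology (d := d) p μ
  exact isClosed_iInter fun v => isClosed_iInter fun _ =>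
    isClosed_eq (continuous_lpTopology_pairing v) continuous_const

theorem exists_mem_eligible_pairing_eq_one (hm : m ≤ mΩ) {w : Lp (Fin d → ℝ) q μ}
    (hw : AEStronglyMeasurable[m] w μ) (hwM : ¬ ∀ᵐ ω ∂μ, w ω ∈ perp M) :
    ∃ e ∈ eligible m p μ M, pairing p w e = 1 := by
  have hww : μ[w | m] =ᵐ[μ] w := condExp_of_aestronglyMeasurable' hm hw
    ((Lp.memLp w).integrable (ENNReal.HolderConjugate.one_le q p))
  have hne : ¬ ∀ u ∈ eligible m p μ M, pairing p w u = 0 := fun h => hwM <| by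
    filter_upwards [(forall_eligible_pairing_eq_zero_iff hm).1 h, hww] with ω hω hωw
      using hωw ▸ hω
  push Not at hne
  obtain ⟨u, hu, hu0⟩ := hne
  exact ⟨(pairing p w u)⁻¹ • u, (eligibleSubmodule m p μ M).smul_mem _ hu, by
    rw [map_smul, smul_eq_mul, inv_mul_cancel₀ hu0]⟩

end Eligible

section Coherent

variable {Ω : Type*} {m mΩ : MeasurableSpace Ω} {μ : Measure Ω} {d : ℕ} {p q : ℝ≥0∞}
  {R : Lp (Fin d → ℝ) p μ → Set (Lp (Fin d → ℝ) p μ)} {M : Submodule ℝ (Fin d → ℝ)}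

theorem const_smul_eq_smul [IsFiniteMeasure μ] (c : ℝ) (X : Lp (Fin d → ℝ) p μ) :
    Lp.const ∞ μ c • X = c • X := by
  ext1
  filter_upwards [Lp.coeFn_lpSMul (r := p) (Lp.const ∞ μ c) X,
    Lp.coeFn_const (p := ∞) (μ := μ) c, Lp.coeFn_smul c X] with ω hsmul hconst hreal
  rw [hsmul, hreal, Pi.smul_apply', Pi.smul_apply, hconst, Function.const_apply]

theorem const_mem_LpIn [IsFiniteMeasure μ] {c : ℝ} {D : Set ℝ} (hc : c ∈ D) :
    Lp.const ∞ μ c ∈ LpIn m ∞ μ (fun _ => D) := by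
  have hconst := Lp.coeFn_const (p := ∞) (μ := μ) c
  refine ⟨⟨fun _ => c, stronglyMeasurable_const, hconst⟩, ?_⟩
  filter_upwards [hconst] with ω hω
  rwa [hω]

theorem IsCondPosHomogeneous.smul_mem [IsFiniteMeasure μ] (h : IsCondPosHomogeneous m p μ R)
    {c : ℝ} (hc : 0 < c) {X u : Lp (Fin d → ℝ) p μ} (hu : u ∈ R X) : c • u ∈ R (c • X) := by
  simpa only [const_smul_eq_smul] using
    h X (Lp.const ∞ μ c) (const_mem_LpIn hc) (mem_image_of_mem _ hu)

theorem IsCondConvex.add_mem [IsFiniteMeasure μ] (h : IsCondConvex m p μ R) {a b : ℝ}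
    (ha : 0 ≤ a) (hb : 0 ≤ b) (hab : a + b = 1) {X Y u u' : Lp (Fin d → ℝ) p μ} (hu : u ∈ R X)
    (hu' : u' ∈ R Y) : a • u + b • u' ∈ R (a • X + b • Y) := by
  have hsub : Lp.const ∞ μ (1 : ℝ) - Lp.const ∞ μ a = Lp.const ∞ μ b := by
    rw [← map_sub, ← hab, add_sub_cancel_left]
  simpa only [hsub, const_smul_eq_smul] using
    h X Y (Lp.const ∞ μ a) (const_mem_LpIn ⟨ha, by linarith⟩)
      (add_mem_add (mem_image_of_mem _ hu) (mem_image_of_mem _ hu'))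

theorem IsCondPosHomogeneous.smul_mem_acceptanceSet (h : IsCondPosHomogeneous m p μ R)
    {Z : Lp (Fin d → ℝ) p μ} (hZ : Z ∈ acceptanceSet p μ R) {g : Lp ℝ ∞ μ}
    (hg : g ∈ LpIn m ∞ μ fun _ => Ioi 0) : g • Z ∈ acceptanceSet p μ R := by
  have hzero : g • (0 : Lp (Fin d → ℝ) p μ) = 0 := Lp.smul_zero (E := Fin d → ℝ) p g
  simpa only [acceptanceSet, mem_ofPred_eq, hzero] using h Z g hg (mem_image_of_mem _ hZ)

theorem eligiblePos_subset_eligible : eligiblePos m p μ M ⊆ eligible m p μ M := fun _ hu =>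
  ⟨hu.1, hu.2.mono fun _ hω => hω.1⟩

theorem zero_mem_eligiblePos : (0 : Lp (Fin d → ℝ) p μ) ∈ eligiblePos m p μ M := by
  have hzero := Lp.coeFn_zero (Fin d → ℝ) p μ
  refine ⟨⟨fun _ => 0, stronglyMeasurable_const, hzero⟩, ?_⟩
  filter_upwards [hzero] with ω hω
  rw [hω]
  exact ⟨M.zero_mem, le_rfl⟩

variable [Fact (1 ≤ p)]

namespace IsConditionalRiskMeasure

theorem sub_mem (hR : IsConditionalRiskMeasure m p μ M R) {X u c : Lp (Fin d → ℝ) p μ}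
    (hu : u ∈ R X) (hc : c ∈ eligible m p μ M) : u - c ∈ R (X + c) := by
  rw [hR.translative X c hc]
  exact mem_image_of_mem _ hu

theorem add_mem_acceptanceSet (hR : IsConditionalRiskMeasure m p μ M R)
    {X u : Lp (Fin d → ℝ) p μ} (hu : u ∈ R X) : X + u ∈ acceptanceSet p μ R := by
  simpa only [acceptanceSet, mem_ofPred_eq, sub_self] using
    hR.sub_mem hu (hR.subset_eligible X hu)

theorem mem_acceptanceSet_of_ae_nonneg (hR : IsConditionalRiskMeasure m p μ M R) (h0 : 0 ∈ R 0)
    {Z : Lp (Fin d → ℝ) p μ} (hZ : ∀ᵐ ω ∂μ, 0 ≤ Z ω) : Z ∈ acceptanceSet p μ R :=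
  hR.monotone 0 Z (by rwa [sub_zero]) h0

theorem eligiblePos_subset (hR : IsConditionalRiskMeasure m p μ M R) (h0 : 0 ∈ R 0) :
    eligiblePos m p μ M ⊆ R 0 := by
  intro u hu
  rw [hR.upper 0]
  exact ⟨0, h0, u, hu, zero_add u⟩

theorem zero_mem [IsFiniteMeasure μ] (hR : IsConditionalRiskMeasure m p μ M R)
    (hcone : IsCondPosHomogeneous m p μ R) : 0 ∈ R 0 := by
  obtain ⟨u, hu⟩ := hR.zero_nonempty
  have hlim : Filter.Tendsto (fun n : ℕ => (1 / ((n : ℝ) + 1)) • u) Filter.atTop (nhds 0) := by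
    simpa using (tendsto_one_div_add_atTop_nhds_zero_nat (𝕜 := ℝ)).smul_const u
  refine (hR.zero_closed.mono norm_topology_le_lpTopology).mem_of_tendsto hlim
    (Filter.Eventually.of_forall fun n => ?_)
  simpa only [smul_zero] using hcone.smul_mem (c := 1 / ((n : ℝ) + 1)) (by positivity) hu

end IsConditionalRiskMeasure

end Coherent

section Localization

variable {Ω : Type*} {m mΩ : MeasurableSpace Ω} {μ : Measure Ω} {d : ℕ} {p q : ℝ≥0∞}

theorem condExp_nonneg_of_forall_setIntegral_nonneg (hm : m ≤ mΩ) [SigmaFinite (μ.trim hm)]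
    {f : Ω → ℝ} (hf : Integrable f μ)
    (hset : ∀ D, MeasurableSet[m] D → 0 ≤ ∫ ω in D, f ω ∂μ) : 0 ≤ᵐ[μ] μ[f | m] := by
  refine ae_le_of_ae_le_trim (hm := hm) (ae_nonneg_of_forall_setIntegral_nonneg
    (integrable_condExp.trim hm stronglyMeasurable_condExp) fun D hD _ => ?_)
  rw [← setIntegral_trim hm stronglyMeasurable_condExp hD, setIntegral_condExp hm hf hD]
  exact hset D hD

theorem setIntegral_nonneg_of_forall_integral_mul_nonneg [IsFiniteMeasure μ] (hm : m ≤ mΩ)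
    {f : Ω → ℝ} (hf : Integrable f μ)
    (hpos : ∀ g ∈ LpIn m ∞ μ fun _ => Ioi (0 : ℝ), 0 ≤ ∫ ω, g ω * f ω ∂μ) {D : Set Ω}
    (hD : MeasurableSet[m] D) : 0 ≤ ∫ ω in D, f ω ∂μ := by
  classical
  have hweight : ∀ ε : ℝ, 0 < ε → 0 ≤ ∫ ω in D, f ω ∂μ + ε * ∫ ω in Dᶜ, f ω ∂μ := by
    intro ε hε
    let g : Ω → ℝ := D.piecewise (fun _ => 1) fun _ => ε
    have hg : Measurable[m] g := Measurable.piecewise hD measurable_const measurable_const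
    have hgL : MemLp g ∞ μ :=
      .piecewise (hm D hD) (memLp_top_const 1) (memLp_top_const ε)
    have hgmem : hgL.toLp g ∈ LpIn m ∞ μ fun _ => Ioi (0 : ℝ) := by
      refine ⟨⟨g, hg.stronglyMeasurable, hgL.coeFn_toLp⟩, ?_⟩
      filter_upwards [hgL.coeFn_toLp] with ω hω
      rw [hω]
      by_cases hωD : ω ∈ D <;> simp [g, hωD, hε]
    have hgf : (fun ω => g ω * f ω) = D.piecewise f fun ω => ε * f ω := by
      ext ω
      by_cases hωD : ω ∈ D <;> simp [g, hωD]
    calc (0 : ℝ) ≤ ∫ ω, hgL.toLp g ω * f ω ∂μ := hpos _ hgmem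
      _ = ∫ ω, g ω * f ω ∂μ := integral_congr_ae (hgL.coeFn_toLp.mul .rfl)
      _ = ∫ ω in D, f ω ∂μ + ε * ∫ ω in Dᶜ, f ω ∂μ := by
        rw [hgf, integral_piecewise (hm D hD) hf.integrableOn (hf.const_mul ε).integrableOn,
          integral_const_mul]
  have hlim : Filter.Tendsto (fun ε : ℝ => ∫ ω in D, f ω ∂μ + ε * ∫ ω in Dᶜ, f ω ∂μ)
      (nhdsWithin 0 (Ioi 0)) (nhds (∫ ω in D, f ω ∂μ)) :=
    (Continuous.tendsto' (by fun_prop) 0 _ (by simp)).mono_left nhdsWithin_le_nhds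
  exact ge_of_tendsto hlim (eventually_mem_nhdsWithin.mono hweight)

theorem condExp_dotProduct_nonneg_of_mem_lpDualCone [IsFiniteMeasure μ]
    [ENNReal.HolderConjugate p q] {R : Lp (Fin d → ℝ) p μ → Set (Lp (Fin d → ℝ) p μ)}
    (hm : m ≤ mΩ) (hcone : IsCondPosHomogeneous m p μ R) {v : Ω → Fin d → ℝ}
    (hv : v ∈ lpDualCone p μ q (acceptanceSet p μ R)) {Z : Lp (Fin d → ℝ) p μ}
    (hZ : Z ∈ acceptanceSet p μ R) : 0 ≤ᵐ[μ] μ[fun ω => v ω ⬝ᵥ Z ω | m] := by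
  have hvZ : Integrable (fun ω => v ω ⬝ᵥ Z ω) μ := integrable_dotProduct hv.1 (Lp.memLp Z)
  refine condExp_nonneg_of_forall_setIntegral_nonneg hm hvZ fun D hD =>
    setIntegral_nonneg_of_forall_integral_mul_nonneg hm hvZ (fun g hg => ?_) hD
  refine (hv.2 _ (hcone.smul_mem_acceptanceSet hZ hg)).trans_eq (integral_congr_ae ?_)
  filter_upwards [Lp.coeFn_lpSMul (r := p) g Z] with ω hω
  rw [hω, Pi.smul_apply', dotProduct_smul, smul_eq_mul]

end Localization

theorem eq_mul_of_forall_nonneg_imp_nonneg {E : Type*} [AddCommGroup E] [Module ℝ E]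
    {N : Submodule ℝ E} {φ ψ : E →ₗ[ℝ] ℝ} (h : ∀ u ∈ N, 0 ≤ ψ u → 0 ≤ φ u) {e : E} (he : e ∈ N)
    (hψe : ψ e = 1) {u : E} (hu : u ∈ N) : φ u = φ e * ψ u := by
  have hproj : u - ψ u • e ∈ N := N.sub_mem hu (N.smul_mem _ he)
  have hpos := h _ hproj (by simp [hψe])
  have hneg := h _ (N.neg_mem hproj) (by simp [hψe])
  simp only [map_neg, map_sub, map_smul, smul_eq_mul] at hpos hneg
  linarith

section StrongDuality

variable {Ω : Type*} {m mΩ : MeasurableSpace Ω} {μ : Measure Ω} {d : ℕ} {p q : ℝ≥0∞}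
  [Fact (1 ≤ p)] [ENNReal.HolderConjugate p q] {M : Submodule ℝ (Fin d → ℝ)}
  {R : Lp (Fin d → ℝ) p μ → Set (Lp (Fin d → ℝ) p μ)} {w : Lp (Fin d → ℝ) q μ}

/-- The positions that some portfolio `u ∈ R Z` of nonpositive expected price `E[wᵀu]` makes
acceptable. A functional separating a position from this cone is a candidate dual variable. -/
def freelyCompensable (R : Lp (Fin d → ℝ) p μ → Set (Lp (Fin d → ℝ) p μ))
    (w : Lp (Fin d → ℝ) q μ) : Set (Lp (Fin d → ℝ) p μ) :=
  {Z | ∃ u ∈ R Z, pairing p w u ≤ 0}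

theorem acceptanceSet_subset_freelyCompensable : acceptanceSet p μ R ⊆ freelyCompensable R w :=
  fun _ hZ => ⟨0, hZ, (map_zero (pairing p w)).le⟩

theorem smul_mem_freelyCompensable [IsFiniteMeasure μ] (hcone : IsCondPosHomogeneous m p μ R)
    {c : ℝ} (hc : 0 < c) {Z : Lp (Fin d → ℝ) p μ} (hZ : Z ∈ freelyCompensable R w) :
    c • Z ∈ freelyCompensable R w := by
  obtain ⟨u, hu, hwu⟩ := hZ
  refine ⟨c • u, hcone.smul_mem hc hu, ?_⟩
  rw [map_smul]
  exact smul_nonpos_of_nonneg_of_nonpos hc.le hwu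

theorem convex_freelyCompensable [IsFiniteMeasure μ] (hconv : IsCondConvex m p μ R) :
    Convex ℝ (freelyCompensable R w) := by
  rintro Z ⟨u, hu, hwu⟩ Z' ⟨u', hu', hwu'⟩ a b ha hb hab
  refine ⟨a • u + b • u', hconv.add_mem ha hb hab hu hu', ?_⟩
  rw [map_add, map_smul, map_smul]
  exact add_nonpos (smul_nonpos_of_nonneg_of_nonpos ha hwu)
    (smul_nonpos_of_nonneg_of_nonpos hb hwu')

theorem add_mem_freelyCompensable_iff (hR : IsConditionalRiskMeasure m p μ M R)
    {Z c : Lp (Fin d → ℝ) p μ} (hc : c ∈ eligible m p μ M) :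
    Z + c ∈ freelyCompensable R w ↔ ∃ u ∈ R Z, pairing p w u ≤ pairing p w c := by
  simp only [freelyCompensable, mem_ofPred_eq, hR.translative Z c hc, exists_mem_image, map_sub,
    sub_nonpos]

theorem eligible_inter_nonpos_add_eligibleNeg
    (hpos : ∀ u ∈ eligiblePos m p μ M, 0 ≤ pairing p w u) :
    (eligible m p μ M ∩ {u | pairing p w u ≤ 0}) + eligibleNeg m p μ M =
      eligible m p μ M ∩ {u | pairing p w u ≤ 0} := by
  refine subset_antisymm ?_ fun u hu => ⟨u, hu, 0, ?_, add_zero u⟩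
  · rintro _ ⟨u, ⟨hu, hwu⟩, n, hn, rfl⟩
    have hnM : n ∈ eligibleSubmodule m p μ M :=
      neg_mem_iff.1 (eligiblePos_subset_eligible (mem_neg.1 hn))
    have hwn : 0 ≤ pairing p w (-n) := hpos _ hn
    refine ⟨(eligibleSubmodule m p μ M).add_mem hu hnM, ?_⟩
    rw [map_neg, neg_nonneg] at hwn
    exact (map_add (pairing p w) u n).trans_le (add_nonpos hwu hwn)
  · simpa only [eligibleNeg, mem_neg, neg_zero] using zero_mem_eligiblePos

theorem isClosed_freelyCompensable [IsFiniteMeasure μ] (hm : m ≤ mΩ)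
    (hR : IsConditionalRiskMeasure m p μ M R) (hcuc : IsConvexUpperContinuous m p μ M R)
    (hpos : ∀ u ∈ eligiblePos m p μ M, 0 ≤ pairing p w u) :
    @IsClosed _ (lpTopology p μ) (freelyCompensable R w) := by
  let D : Set (Lp (Fin d → ℝ) p μ) := eligible m p μ M ∩ {u | pairing p w u ≤ 0}
  have hconv : Convex ℝ D := (eligibleSubmodule m p μ M).convex.inter
    ((convex_Iic (0 : ℝ)).linear_preimage (pairing p w).toLinearMap)
  have hclosed : @IsClosed _ (lpTopology p μ) D :=
    @IsClosed.inter _ _ _ (lpTopology p μ) (isClosed_eligible hm)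
      (@IsClosed.preimage _ _ (lpTopology p μ) _ _ (continuous_lpTopology_pairing w) _ isClosed_Iic)
  have hD := hcuc D inter_subset_left (by
    rw [eligible_inter_nonpos_add_eligibleNeg hpos, hconv.convexHull_eq]
    exact (@IsClosed.closure_eq _ (lpTopology p μ) _ hclosed).symm)
  convert hD using 1
  ext Z
  exact ⟨fun ⟨u, hu, hwu⟩ => ⟨u, hu, hR.subset_eligible Z hu, hwu⟩,
    fun ⟨u, hu, _, hwu⟩ => ⟨u, hu, hwu⟩⟩

theorem pairing_eq_mul_of_nonneg_on_freelyCompensable (hR : IsConditionalRiskMeasure m p μ M R)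
    (h0 : 0 ∈ R 0) {y : Lp (Fin d → ℝ) q μ} (hy : ∀ Z ∈ freelyCompensable R w, 0 ≤ pairing p y Z)
    {e : Lp (Fin d → ℝ) p μ} (he : e ∈ eligible m p μ M) (hwe : pairing p w e = 1)
    {u : Lp (Fin d → ℝ) p μ} (hu : u ∈ eligible m p μ M) :
    pairing p y u = pairing p y e * pairing p w u := by
  refine eq_mul_of_forall_nonneg_imp_nonneg (N := eligibleSubmodule m p μ M)
    (φ := (pairing p y).toLinearMap) (ψ := (pairing p w).toLinearMap) (fun c hc hwc => ?_) he hwe hu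
  have hmem : 0 + c ∈ freelyCompensable R w :=
    (add_mem_freelyCompensable_iff hR hc).2 ⟨0, h0, (map_zero (pairing p w)).trans_le hwc⟩
  exact hy c (zero_add c ▸ hmem)

theorem exists_pairing_nonneg_on_freelyCompensable [IsFiniteMeasure μ] (hm : m ≤ mΩ)
    (hR : IsConditionalRiskMeasure m p μ M R) (hcuc : IsConvexUpperContinuous m p μ M R)
    (hcoh : IsCondCoherent m p μ R) (hpos : ∀ u ∈ eligiblePos m p μ M, 0 ≤ pairing p w u)
    {e : Lp (Fin d → ℝ) p μ} (he : e ∈ eligible m p μ M) (hwe : pairing p w e = 1)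
    {X : Lp (Fin d → ℝ) p μ} (hX : (R X).Nonempty) {a : ℝ} (ha : ∀ u ∈ R X, a < pairing p w u) :
    ∃ y : Lp (Fin d → ℝ) q μ, (∀ Z ∈ freelyCompensable R w, 0 ≤ pairing p y Z) ∧
      0 < pairing p y e ∧ pairing p y X + a * pairing p y e < 0 := by
  have hse (s : ℝ) : s • e ∈ eligible m p μ M := (eligibleSubmodule m p μ M).smul_mem s he
  have hwse (s : ℝ) : pairing p w (s • e) = s := by rw [map_smul, hwe, smul_eq_mul, mul_one]
  have hz : X + a • e ∉ freelyCompensable R w := by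
    rw [add_mem_freelyCompensable_iff hR (hse a), hwse]
    exact fun ⟨u, hu, hwu⟩ => hwu.not_gt (ha u hu)
  obtain ⟨y, hy, hyz⟩ := exists_pairing_of_notMem_cone (q := q)
    (convex_freelyCompensable hcoh.1) (isClosed_freelyCompensable hm hR hcuc hpos)
    (acceptanceSet_subset_freelyCompensable (hR.zero_mem hcoh.2))
    (fun c hc Z hZ => smul_mem_freelyCompensable hcoh.2 hc hZ) hz
  rw [map_add, map_smul, smul_eq_mul] at hyz
  refine ⟨y, hy, ?_, hyz⟩
  obtain ⟨u, hu⟩ := hX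
  have hyu := hy _ ((add_mem_freelyCompensable_iff hR (hse (pairing p w u))).2
    ⟨u, hu, (hwse _).ge⟩)
  rw [map_add, map_smul, smul_eq_mul] at hyu
  exact pos_of_mul_pos_right (a := pairing p w u - a) (by linarith) (sub_pos.2 (ha u hu)).le

theorem exists_mem_lpDualCone_lt_neg_pairing [IsFiniteMeasure μ] (hm : m ≤ mΩ)
    (hR : IsConditionalRiskMeasure m p μ M R) (hcuc : IsConvexUpperContinuous m p μ M R)
    (hcoh : IsCondCoherent m p μ R) (hpos : ∀ u ∈ eligiblePos m p μ M, 0 ≤ pairing p w u)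
    {e : Lp (Fin d → ℝ) p μ} (he : e ∈ eligible m p μ M) (hwe : pairing p w e = 1)
    {X : Lp (Fin d → ℝ) p μ} (hX : (R X).Nonempty) {a : ℝ} (ha : ∀ u ∈ R X, a < pairing p w u) :
    ∃ v : Lp (Fin d → ℝ) q μ, ⇑v ∈ lpDualCone p μ q (acceptanceSet p μ R) ∧
      (∀ᵐ ω ∂μ, 0 ≤ v ω) ∧ (∀ u ∈ eligible m p μ M, pairing p v u = pairing p w u) ∧
      a < -pairing p v X := by
  have h0 := hR.zero_mem hcoh.2
  obtain ⟨y, hy, hye, hyX⟩ :=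
    exists_pairing_nonneg_on_freelyCompensable hm hR hcuc hcoh hpos he hwe hX ha
  have hv (Z : Lp (Fin d → ℝ) p μ) :
      pairing p ((pairing p y e)⁻¹ • y) Z = (pairing p y e)⁻¹ * pairing p y Z := by
    simp [pairing]
  have hvA : ∀ Z ∈ acceptanceSet p μ R, 0 ≤ pairing p ((pairing p y e)⁻¹ • y) Z := fun Z hZ => by
    rw [hv]
    exact mul_nonneg (inv_nonneg.2 hye.le) (hy Z (acceptanceSet_subset_freelyCompensable hZ))
  refine ⟨(pairing p y e)⁻¹ • y, ⟨Lp.memLp _, fun Z hZ => ?_⟩, ?_, fun u hu => ?_, ?_⟩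
  · exact (hvA Z hZ).trans_eq (pairing_apply _ Z)
  · exact ae_nonneg_of_forall_pairing_nonneg fun Z hZ =>
      hvA Z (hR.mem_acceptanceSet_of_ae_nonneg h0 hZ)
  · rw [hv, pairing_eq_mul_of_nonneg_on_freelyCompensable hR h0 hy he hwe hu,
      inv_mul_cancel_left₀ hye.ne']
  · rw [hv, ← mul_neg, lt_inv_mul_iff₀ hye]
    linarith

end StrongDuality

section EssSup

variable {Ω κ κ' : Type*} {m mΩ : MeasurableSpace Ω} {μ : Measure Ω} {V W : Ω → EReal}
  {Y : Ω → ℝ}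

theorem IsFamEssInf.nonempty_of_ae_eq_coe [NeZero μ] {f : κ → Ω → EReal}
    (hV : IsFamEssInf m μ f V) (hVY : V =ᵐ[μ] fun ω => (Y ω : EReal)) : Nonempty κ := by
  by_contra hempty
  obtain ⟨ω, htop, hω⟩ := ((hV.greatest (fun _ => ⊤) measurable_const fun i =>
    absurd ⟨i⟩ hempty).and hVY).exists
  exact EReal.coe_ne_top (Y ω) (top_le_iff.1 (htop.trans_eq hω))

theorem IsFamEssInf.integral_le {f : κ → Ω → ℝ}
    (hV : IsFamEssInf m μ (fun i ω => (f i ω : EReal)) V)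
    (hVY : V =ᵐ[μ] fun ω => (Y ω : EReal)) (hY : Integrable Y μ) {i : κ}
    (hi : Integrable (f i) μ) : ∫ ω, Y ω ∂μ ≤ ∫ ω, f i ω ∂μ := by
  refine integral_mono_ae hY hi ?_
  filter_upwards [hV.lower i, hVY] with ω hle hω
  exact EReal.coe_le_coe_iff.1 (hω ▸ hle)

theorem IsFamEssSup.le_isFamEssInf {f : κ → Ω → EReal} {g : κ' → Ω → EReal}
    (hV : IsFamEssSup m μ f V) (hW : IsFamEssInf m μ g W)
    (hg : ∀ j, AEStronglyMeasurable[m] (g j) μ) (hfg : ∀ i j, f i ≤ᵐ[μ] g j) : V ≤ᵐ[μ] W := by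
  refine hW.greatest V hV.measurable fun j => ?_
  obtain ⟨g', hg', hgg'⟩ := hg j
  exact (hV.least g' hg'.measurable fun i => (hfg i j).trans hgg'.le).trans hgg'.symm.le

theorem IsFamEssSup.ae_eq_of_forall_lt_exists_integral (hm : m ≤ mΩ) {f : κ → Ω → ℝ}
    (hV : IsFamEssSup m μ (fun i ω => (f i ω : EReal)) V) (hY : Integrable Y μ)
    (hVY : V ≤ᵐ[μ] fun ω => (Y ω : EReal))
    (hlt : ∀ a < ∫ ω, Y ω ∂μ, ∃ i, Integrable (f i) μ ∧ a < ∫ ω, f i ω ∂μ) :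
    V =ᵐ[μ] fun ω => (Y ω : EReal) := by
  obtain ⟨i₀, hi₀, -⟩ := hlt (∫ ω, Y ω ∂μ - 1) (by linarith)
  have hreal : ∀ᵐ ω ∂μ, ((V ω).toReal : EReal) = V ω := by
    filter_upwards [hVY, hV.upper i₀] with ω hle hge
    exact EReal.coe_toReal (ne_top_of_le_ne_top (EReal.coe_ne_top _) hle)
      (ne_bot_of_le_ne_bot (EReal.coe_ne_bot _) hge)
  have hfV (i : κ) : f i ≤ᵐ[μ] fun ω => (V ω).toReal := by
    filter_upwards [hV.upper i, hreal] with ω hle hω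
    exact EReal.coe_le_coe_iff.1 (hω.symm ▸ hle)
  have hVY' : (fun ω => (V ω).toReal) ≤ᵐ[μ] Y := by
    filter_upwards [hVY, hreal] with ω hle hω
    exact EReal.coe_le_coe_iff.1 (hω.symm ▸ hle)
  have hVi : Integrable (fun ω => (V ω).toReal) μ :=
    integrable_of_le_of_le (hV.measurable.mono hm le_rfl).ereal_toReal.aestronglyMeasurable
      (hfV i₀) hVY' hi₀ hY
  have hint : ∫ ω, Y ω ∂μ ≤ ∫ ω, (V ω).toReal ∂μ := by
    refine le_of_forall_lt fun a ha => ?_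
    obtain ⟨i, hi, hai⟩ := hlt a ha
    exact hai.trans_le (integral_mono_ae hi hVi (hfV i))
  have heq : (fun ω => (V ω).toReal) =ᵐ[μ] Y :=
    (integral_eq_iff_of_ae_le hVi hY hVY').1 ((integral_mono_ae hVi hY hVY').antisymm hint)
  filter_upwards [heq, hreal] with ω hω hωV
  rw [← hωV, hω]

end EssSup

section Representation

variable {Ω : Type*} {m mΩ : MeasurableSpace Ω} {μ : Measure Ω} {ι : Type*} [Preorder ι]
  {ℱ : Filtration ι mΩ} {t T : ι} {d : ℕ} {p q : ℝ≥0∞} {M : Submodule ℝ (Fin d → ℝ)}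
  {R : Lp (Fin d → ℝ) p μ → Set (Lp (Fin d → ℝ) p μ)} {w : Lp (Fin d → ℝ) q μ}
  {x : (Fin d → Measure Ω) × Lp (Fin d → ℝ) q μ}

/-- The value `(w + m_⊥)ᵀ E^Q[-X | ℱ_t]` of the dual pair `x = (Q, m_⊥)` at the position `X`. -/
noncomputable def dualValue (ℱ : Filtration ι mΩ) (μ : Measure Ω) (t T : ι)
    (w : Lp (Fin d → ℝ) q μ) (X : Lp (Fin d → ℝ) p μ)
    (x : (Fin d → Measure Ω) × Lp (Fin d → ℝ) q μ) : Ω → ℝ :=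
  fun ω => (w + x.2) ω ⬝ᵥ condExpQ ℱ μ t T x.1 (-X) ω

theorem aestronglyMeasurable_dotProduct {v u : Ω → Fin d → ℝ} (hv : AEStronglyMeasurable[m] v μ)
    (hu : AEStronglyMeasurable[m] u μ) : AEStronglyMeasurable[m] (fun ω => v ω ⬝ᵥ u ω) μ := by
  simpa only [Function.uncurry_apply_pair, dotL_apply] using
    (dotL d).continuous₂.comp_aestronglyMeasurable (hv.prodMk hu)

theorem transport_congr_ae (Q : Fin d → Measure Ω) {w w' : Ω → Fin d → ℝ} (h : w =ᵐ[μ] w') :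
    transport ℱ μ t T Q w =ᵐ[μ] transport ℱ μ t T Q w' := by
  filter_upwards [h] with ω hω
  funext i
  simp only [transport, hω]

theorem mem_lpDualCone_congr_ae {A : Set (Lp (Fin d → ℝ) p μ)} {v v' : Ω → Fin d → ℝ}
    (h : v =ᵐ[μ] v') : v ∈ lpDualCone p μ q A ↔ v' ∈ lpDualCone p μ q A := by
  have hZ (Z : Lp (Fin d → ℝ) p μ) : ∫ ω, v ω ⬝ᵥ Z ω ∂μ = ∫ ω, v' ω ⬝ᵥ Z ω ∂μ :=
    integral_congr_ae (h.mono fun ω hω => by simp only [hω])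
  simp only [lpDualCone, mem_ofPred_eq, memLp_congr_ae h, hZ]

section HolderConjugate

variable [ENNReal.HolderConjugate p q]

theorem dualValue_ae_eq_condExp [IsFiniteMeasure μ] (htT : t ≤ T)
    (hx : x ∈ dualPairsAt ℱ μ M q t T w) (X : Lp (Fin d → ℝ) p μ) :
    dualValue ℱ μ t T w X x =ᵐ[μ]
      μ[fun ω => -(transport ℱ μ t T x.1 ⇑(w + x.2) ω ⬝ᵥ X ω) | ℱ t] := by
  obtain ⟨-, -, -, ⟨hwm, -⟩, htrL, htr0⟩ := hx
  have h := dotProduct_condExpQ_ae_eq htT hwm htrL htr0 (Lp.memLp X).neg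
  simp only [Pi.neg_apply, dotProduct_neg] at h
  exact h

theorem condExp_transport_dotProduct_eligible [IsFiniteMeasure μ] (htT : t ≤ T)
    (hx : x ∈ dualPairsAt ℱ μ M q t T w) {u : Lp (Fin d → ℝ) p μ}
    (hu : u ∈ eligible (ℱ t) p μ M) :
    μ[fun ω => transport ℱ μ t T x.1 ⇑(w + x.2) ω ⬝ᵥ u ω | ℱ t] =ᵐ[μ]
      fun ω => w ω ⬝ᵥ u ω := by
  obtain ⟨-, ⟨-, hperp⟩, -, ⟨hwm, -⟩, htrL, -⟩ := hx
  have hint := htrL.integrable (ENNReal.HolderConjugate.one_le q p)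
  filter_upwards [condExp_dotProduct_of_aestronglyMeasurable_right htrL (Lp.memLp u) hu.1,
    condExp_transport htT hwm hint, hperp, hu.2, Lp.coeFn_add w x.2] with ω hdot htr hωperp hωM hadd
  rw [hdot, htr, hadd, Pi.add_apply, add_dotProduct, hωperp _ hωM, add_zero]

theorem dualValue_le_dotProduct [IsFiniteMeasure μ] [Fact (1 ≤ p)] (htT : t ≤ T)
    (hR : IsConditionalRiskMeasure (ℱ t) p μ M R)
    (hcone : IsCondPosHomogeneous (ℱ t) p μ R) (hx : x ∈ coherentDualPairs ℱ μ M q t T R w)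
    {X u : Lp (Fin d → ℝ) p μ} (hu : u ∈ R X) :
    dualValue ℱ μ t T w X x ≤ᵐ[μ] fun ω => w ω ⬝ᵥ u ω := by
  let v : Ω → Fin d → ℝ := transport ℱ μ t T x.1 ⇑(w + x.2)
  have hvZ (Z : Lp (Fin d → ℝ) p μ) : Integrable (fun ω => v ω ⬝ᵥ Z ω) μ :=
    integrable_dotProduct hx.2.1 (Lp.memLp Z)
  have hsum : μ[fun ω => v ω ⬝ᵥ (X + u) ω | ℱ t] =ᵐ[μ]
      μ[fun ω => v ω ⬝ᵥ u ω | ℱ t] - μ[fun ω => -(v ω ⬝ᵥ X ω) | ℱ t] := by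
    refine (condExp_congr_ae ?_).trans (condExp_sub (hvZ u) (hvZ X).neg _)
    filter_upwards [Lp.coeFn_add X u] with ω hω
    rw [hω, Pi.add_apply, dotProduct_add, Pi.sub_apply, Pi.neg_apply, sub_neg_eq_add, add_comm]
  filter_upwards [hsum, condExp_dotProduct_nonneg_of_mem_lpDualCone (ℱ.le t) hcone hx.2
      (hR.add_mem_acceptanceSet hu), dualValue_ae_eq_condExp htT hx.1 X,
    condExp_transport_dotProduct_eligible htT hx.1 (hR.subset_eligible X hu)]
    with ω hω hpos hvalue hprice
  exact sub_nonneg.1 (hpos.trans_eq (by rw [hω, Pi.sub_apply, hvalue, hprice]))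

theorem pairing_nonneg_of_mem_eligiblePos [Fact (1 ≤ p)]
    (hR : IsConditionalRiskMeasure m p μ M R)
    (h0 : 0 ∈ R 0) {S : Ω → Set (Fin d → ℝ)} (hS : IsZeroSet m p μ R S)
    (hw : ∀ᵐ ω ∂μ, w ω ∈ dualCone (S ω)) {u : Lp (Fin d → ℝ) p μ}
    (hu : u ∈ eligiblePos m p μ M) : 0 ≤ pairing p w u := by
  have huS : u ∈ LpIn m p μ S := hS.2 ▸ hR.eligiblePos_subset h0 hu
  rw [pairing_apply]
  refine integral_nonneg_of_ae ?_
  filter_upwards [hw, huS.2] with ω hωw hωu using hωw _ hωu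

theorem condExp_sub_mem_perp [IsFiniteMeasure μ] [Fact (1 ≤ p)] (hm : m ≤ mΩ)
    (hw : AEStronglyMeasurable[m] w μ)
    {v : Lp (Fin d → ℝ) q μ} (hvw : ∀ u ∈ eligible m p μ M, pairing p v u = pairing p w u) :
    ∀ᵐ ω ∂μ, μ[v | m] ω - w ω ∈ perp M := by
  have hq : 1 ≤ q := ENNReal.HolderConjugate.one_le q p
  have hvi : Integrable v μ := (Lp.memLp v).integrable hq
  have hwi : Integrable w μ := (Lp.memLp w).integrable hq
  have hsub : ∀ u ∈ eligible m p μ M, pairing p (v - w) u = 0 := fun u hu => by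
    rw [← sub_eq_zero.2 (hvw u hu)]
    simp [pairing]
  have hcond : μ[⇑(v - w) | m] =ᵐ[μ] μ[v | m] - w :=
    (condExp_congr_ae (Lp.coeFn_sub v w)).trans ((condExp_sub hvi hwi m).trans
      (Filter.EventuallyEq.rfl.sub (condExp_of_aestronglyMeasurable' hm hw hwi)))
  filter_upwards [(forall_eligible_pairing_eq_zero_iff hm).1 hsub, hcond] with ω hperp hω
  rwa [hω] at hperp

end HolderConjugate

theorem mem_dualCone_posPart_of_nonneg {b : Fin d → ℝ} (hb : 0 ≤ b) : b ∈ dualCone (posPart M) :=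
  fun _ hu => dotProduct_nonneg_of_nonneg hb hu.2

variable [Fact (1 ≤ p)] [ENNReal.HolderConjugate p q] [IsProbabilityMeasure μ]

theorem exists_mem_coherentDualPairs (hT : ℱ T = mΩ) (hw : AEStronglyMeasurable[ℱ t] w μ)
    (hwM : ∀ᵐ ω ∂μ, w ω ∉ perp M) {v : Lp (Fin d → ℝ) q μ}
    (hv : ⇑v ∈ lpDualCone p μ q (acceptanceSet p μ R)) (hv0 : ∀ᵐ ω ∂μ, 0 ≤ v ω)
    (hvw : ∀ u ∈ eligible (ℱ t) p μ M, pairing p v u = pairing p w u) :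
    ∃ x ∈ coherentDualPairs ℱ μ M q t T R w, transport ℱ μ t T x.1 ⇑(w + x.2) =ᵐ[μ] v := by
  have hq : 1 ≤ q := ENNReal.HolderConjugate.one_le q p
  have hvi : Integrable v μ := (Lp.memLp v).integrable hq
  have hb : MemLp μ[v | ℱ t] q μ := (Lp.memLp v).condExp hq
  have hbm : AEStronglyMeasurable[ℱ t] hb.toLp μ :=
    stronglyMeasurable_condExp.aestronglyMeasurable.congr hb.coeFn_toLp.symm
  have hsub : ⇑(hb.toLp - w) =ᵐ[μ] μ[v | ℱ t] - w :=
    (Lp.coeFn_sub _ w).trans (hb.coeFn_toLp.sub .rfl)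
  have hperp := condExp_sub_mem_perp (ℱ.le t) hw hvw
  obtain ⟨Q, hQ, htrQ⟩ := exists_measureVectors_transport_condExp (t := t) hT hvi hv0
  have htr : transport ℱ μ t T Q hb.toLp =ᵐ[μ] v :=
    (transport_congr_ae Q hb.coeFn_toLp).trans htrQ
  refine ⟨(Q, hb.toLp - w), ⟨⟨hQ, ⟨?_, ?_⟩, hQ, ⟨?_, ?_⟩, ?_, ?_⟩, ?_⟩, ?_⟩ <;>
    simp only [add_sub_cancel]
  · exact (hbm.sub hw).congr (Lp.coeFn_sub _ w).symm
  · filter_upwards [hsub, hperp] with ω hω hωperp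
    rwa [hω]
  · exact hbm
  · filter_upwards [hb.coeFn_toLp, ae_condExp_nonneg hvi hv0, hperp, hwM] with ω hω hω0 hωperp hωM
    rw [hω]
    refine ⟨mem_dualCone_posPart_of_nonneg hω0, fun hωb => hωM ?_⟩
    have hωw := (perpSubmodule M).sub_mem hωb hωperp
    rwa [sub_sub_cancel] at hωw
  · exact (memLp_congr_ae htr).2 (Lp.memLp v)
  · filter_upwards [htr, hv0] with ω hω hω0
    rwa [hω]
  · exact (mem_lpDualCone_congr_ae htr).2 hv
  · exact htr

theorem exists_mem_coherentDualPairs_lt_integral_dualValue (htT : t ≤ T) (hT : ℱ T = mΩ)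
    (hR : IsConditionalRiskMeasure (ℱ t) p μ M R)
    (hcuc : IsConvexUpperContinuous (ℱ t) p μ M R) (hcoh : IsCondCoherent (ℱ t) p μ R)
    {S : Ω → Set (Fin d → ℝ)} (hS : IsZeroSet (ℱ t) p μ R S)
    (hw : w ∈ LpIn (ℱ t) q μ fun ω => dualCone (S ω) \ perp M)
    {X : Lp (Fin d → ℝ) p μ} (hX : (R X).Nonempty) {a : ℝ} (ha : ∀ u ∈ R X, a < pairing p w u) :
    ∃ x ∈ coherentDualPairs ℱ μ M q t T R w, Integrable (dualValue ℱ μ t T w X x) μ ∧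
      a < ∫ ω, dualValue ℱ μ t T w X x ω ∂μ := by
  have hwS : ∀ᵐ ω ∂μ, w ω ∈ dualCone (S ω) := hw.2.mono fun _ h => h.1
  have hwM : ∀ᵐ ω ∂μ, w ω ∉ perp M := hw.2.mono fun _ h => h.2
  obtain ⟨e, he, hwe⟩ := exists_mem_eligible_pairing_eq_one (p := p) (ℱ.le t) hw.1 fun h =>
    (h.and hwM).exists.elim fun _ hω => hω.2 hω.1
  obtain ⟨v, hv, hv0, hvw, hav⟩ := exists_mem_lpDualCone_lt_neg_pairing (ℱ.le t) hR hcuc hcoh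
    (fun u hu => pairing_nonneg_of_mem_eligiblePos hR (hR.zero_mem hcoh.2) hS hwS hu) he hwe hX ha
  obtain ⟨x, hx, hxv⟩ := exists_mem_coherentDualPairs hT hw.1 hwM hv hv0 hvw
  have hvalue := dualValue_ae_eq_condExp htT hx.1 X
  refine ⟨x, hx, integrable_condExp.congr hvalue.symm, hav.trans_eq ?_⟩
  calc -pairing p v X = ∫ ω, -(v ω ⬝ᵥ X ω) ∂μ := by rw [pairing_apply, integral_neg]
    _ = ∫ ω, -(transport ℱ μ t T x.1 ⇑(w + x.2) ω ⬝ᵥ X ω) ∂μ :=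
      integral_congr_ae (hxv.mono fun ω hω => by simp only [hω])
    _ = ∫ ω, dualValue ℱ μ t T w X x ω ∂μ := by
      rw [integral_congr_ae hvalue, integral_condExp (ℱ.le t)]

end Representation

end SetRisk

theorem corollary3p4_general
    {Ω : Type*} [mΩ : MeasurableSpace Ω] (P : Measure Ω) [IsProbabilityMeasure P]
    {ι : Type*} [Preorder ι] (ℱ : Filtration ι mΩ) (t T : ι) (htT : t ≤ T) (hT : ℱ T = mΩ)
    (p q : ℝ≥0∞) [Fact (1 ≤ p)] [ENNReal.HolderConjugate p q]
    {d : ℕ} (M : Submodule ℝ (Fin d → ℝ))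
    (R : Lp (Fin d → ℝ) p P → Set (Lp (Fin d → ℝ) p P))
    (hR : SetRisk.IsConditionalRiskMeasure (ℱ t) p P M R)
    (hcuc : SetRisk.IsConvexUpperContinuous (ℱ t) p P M R)
    (hcoh : SetRisk.IsCondCoherent (ℱ t) p P R)
    (S : Ω → Set (Fin d → ℝ)) (hS : SetRisk.IsZeroSet (ℱ t) p P R S)
    (w : Lp (Fin d → ℝ) q P)
    (hw : w ∈ SetRisk.LpIn (ℱ t) q P (fun ω => SetRisk.dualCone (S ω) \ SetRisk.perp M))
    (X : Lp (Fin d → ℝ) p P)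
    (hint : ∃ Y : Ω → ℝ, Integrable Y P ∧
      SetRisk.scalarization R (ℱ.le t) w X =ᵐ[P] fun ω => (Y ω : EReal)) :
    SetRisk.scalarization R (ℱ.le t) w X =ᵐ[P]
      SetRisk.famEssSup (ℱ.le t) P
        (fun (x : SetRisk.coherentDualPairs ℱ P M q t T R w) ω =>
          (((w + x.1.2) ω ⬝ᵥ SetRisk.condExpQ ℱ P t T x.1.1 (-X) ω : ℝ) : EReal)) := by
  obtain ⟨Y, hY, hρY⟩ := hint
  have hρ := SetRisk.isFamEssInf_famEssInf (ℱ.le t) P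
    fun (u : R X) ω => ((w ω ⬝ᵥ u.1 ω : ℝ) : EReal)
  have hσ := SetRisk.isFamEssSup_famEssSup (ℱ.le t) P
    fun (x : SetRisk.coherentDualPairs ℱ P M q t T R w) ω =>
      ((SetRisk.dualValue ℱ P t T w X x.1 ω : ℝ) : EReal)
  obtain ⟨u₀, hu₀⟩ := hρ.nonempty_of_ae_eq_coe hρY
  have hweak := hσ.le_isFamEssInf hρ
    (fun u => continuous_coe_real_ereal.comp_aestronglyMeasurable
      (SetRisk.aestronglyMeasurable_dotProduct hw.1 (hR.subset_eligible X u.2).1))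
    fun x u => (SetRisk.dualValue_le_dotProduct htT hR hcoh.2 x.2 u.2).mono
      fun _ => EReal.coe_le_coe
  refine hρY.trans (hσ.ae_eq_of_forall_lt_exists_integral (ℱ.le t) hY (hweak.trans hρY.le)
    fun a ha => ?_).symm
  have hprice (u : Lp (Fin d → ℝ) p P) (hu : u ∈ R X) : a < SetRisk.pairing p w u := by
    rw [SetRisk.pairing_apply]
    exact ha.trans_le (hρ.integral_le (i := ⟨u, hu⟩) hρY hY
      (SetRisk.integrable_dotProduct (Lp.memLp w) (Lp.memLp u)))
  obtain ⟨x, hx, hxi, hax⟩ := SetRisk.exists_mem_coherentDualPairs_lt_integral_dualValue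
    htT hT hR hcuc hcoh hS hw ⟨u₀, hu₀⟩ hprice
  exact ⟨⟨x, hx⟩, hxi, hax⟩

theorem corollary3p4
    {Ω : Type*} [mΩ : MeasurableSpace Ω] (P : Measure Ω) [IsProbabilityMeasure P]
    {ι : Type*} [LinearOrder ι] (ℱ : Filtration ι mΩ) (t T : ι) (htT : t ≤ T) (hT : ℱ T = mΩ)
    (p q : ℝ≥0∞) [Fact (1 ≤ p)] [ENNReal.HolderConjugate p q]
    (d m : ℕ) (hm : 1 ≤ m) (hmd : m ≤ d)
    (R : Lp (Fin d → ℝ) p P → Set (Lp (Fin d → ℝ) p P))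
    (hR : SetRisk.IsConditionalRiskMeasure (ℱ t) p P (SetRisk.eligibleSpace d m) R)
    (hnorm : SetRisk.IsNormalized p P R)
    (hcuc : SetRisk.IsConvexUpperContinuous (ℱ t) p P (SetRisk.eligibleSpace d m) R)
    (hcoh : SetRisk.IsCondCoherent (ℱ t) p P R)
    (S : Ω → Set (Fin d → ℝ)) (hS : SetRisk.IsZeroSet (ℱ t) p P R S)
    (hint : ∀ w ∈ SetRisk.LpIn (ℱ t) q P
        (fun ω => SetRisk.dualCone (S ω) \ SetRisk.perp (SetRisk.eligibleSpace d m)),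
      ∀ X : Lp (Fin d → ℝ) p P, ∃ Y : Ω → ℝ, Integrable Y P ∧
        SetRisk.scalarization R (ℱ.le t) w X =ᵐ[P] fun ω => (Y ω : EReal))
    (w : Lp (Fin d → ℝ) q P)
    (hw : w ∈ SetRisk.LpIn (ℱ t) q P
      (fun ω => SetRisk.dualCone (S ω) \ SetRisk.perp (SetRisk.eligibleSpace d m)))
    (X : Lp (Fin d → ℝ) p P) :
    SetRisk.scalarization R (ℱ.le t) w X =ᵐ[P]
      SetRisk.famEssSup (ℱ.le t) P
        (fun (x : SetRisk.coherentDualPairs ℱ P (SetRisk.eligibleSpace d m) q t T R w) ω =>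
          (((w + x.1.2) ω ⬝ᵥ SetRisk.condExpQ ℱ P t T x.1.1 (-X) ω : ℝ) : EReal)) :=
  corollary3p4_general P ℱ t T htT hT p q _ R hR hcuc hcoh S hS w hw X (hint w hw X)
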